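/- **Setting.** Let $d=d_1+d_2$, let $\mathrm E(n)$ be the group of isometries of $\mathbb R^n$ and $\mathrm O(n)$ the orthogonal group, and for $A\in \mathrm O(d_1)$, $h\in \mathrm E(d_2)$ let $A\oplus h\in \mathrm E(d)$ be the isometry $(x_1,x_2)\mapsto(Ax_1,h x_2)$ of $\mathbb R^{d_1}\times\mathbb R^{d_2}$. A subgroup of $\mathrm E(n)$ is called discrete if all its orbits are discrete; a space group is a discrete subgroup of $\mathrm E(n)$ containing $n$ translations with linearly independent translation vectors. For $g\in \mathrm E(d)$ let $\mathrm{rot}(g)\in \mathrm O(d)$ be its linear part. Let $\mathcal G<\mathrm E(d)$ be a nontrivial discrete group all of whose elements are of the form $A\oplus h$ and whose image $\mathcal S$ under $\pi\colon A\oplus h\mapsto h$ is a $d_2$-dimensional space group. Let $\mathcal T\subset\mathcal G$ be a set which $\pi$ maps bijectively onto the set of translations of $\mathcal S$, put $\mathcal T^N=\{t^N: t\in\mathcal T\}$, and let $M_0$ be the set of integers $N\ge 1$ for which $\mathcal T^N$ is a normal subgroup of $\mathcal G$. A function $u$ on $\mathcal G$ is $\mathcal T^N$-periodic if $u(gt)=u(g)$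 for all $g\in\mathcal G$, $t\in\mathcal T^N$, and periodic if it is $\mathcal T^N$-periodic for some $N\in M_0$. Let $U_{\rm per}$ be the space of periodic functions $\mathcal G\to\mathbb R^d$ with the uniform norm, and for $N\in M_0$ let $\mathcal C_N$ be a (finite) set of representatives of $\mathcal G/\mathcal T^N$. **Energy.** Let $x_0\in\mathbb R^d$ be such that $g\mapsto g\cdot x_0$ is injective on $\mathcal G$, and write $\mathcal G^*=\mathcal G\setminus\{\mathrm{id}\}$ and $y_0=(g\cdot x_0-x_0)_{g\in\mathcal G^*}$. Let $V\colon(\mathbb R^d)^{\mathcal G^*}\to\mathbb R$ satisfy $V(Qy)=V(y)$ for all $Q\in \mathrm O(d)$ and all $y$; let $z\mapsto V(y+z)$ be twice continuously Fréchet differentiable on $L^\infty(\mathcal G^*,\mathbb R^d)$ for every $y$, with derivatives at $z=0$ denoted by $V'(y),V''(y)$; with $(\partial_gV(y))_i=V'(y)(\delta_ge_i)$ and $(\partial_g\partial_hV(y))_{ij}=V''(y)(\delta_ge_i,\delta_he_j)$ let $\sum_{g}\|\partial_gV(y)\|<\infty$ and $\sum_{g,h}\|\partial_g\partial_hV(y)\|<\infty$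 for every $y$; and assume that $$V''(y_0)(z_1,z_2)=\sum_{g,h\in\mathcal G^*}z_1(g)^{\mathsf T}\,\partial_g\partial_hV(y_0)\,z_2(h)\qquad\text{for all }z_1,z_2\in L^\infty(\mathcal G^*,\mathbb R^d)$$ (which is automatic if $V$ depends on finitely many $y(g)$ only). For a $\mathcal T^N$-periodic $w\in U_{\rm per}$ put $$E(w)=\frac1{|\mathcal C_N|}\sum_{g\in\mathcal C_N}V\Big(\big((gh)\cdot w(gh)-g\cdot w(g)\big)_{h\in\mathcal G^*}\Big),$$ and let $E''(x_0)$ be the second Fréchet derivative of $E\colon U_{\rm per}\to\mathbb R$ at the constant function $x_0$. **Seminorms and stability constants.** Let $\mathcal R\subset\mathcal G$ be finite with $\mathcal R'\mathcal R''\subset\mathcal R$ for some $\mathcal R',\mathcal R''\subset\mathcal G$ such that $\mathrm{id}\in\mathcal R'$, $\mathcal R'$ generates $\mathcal G$, $\mathcal R''$ is finite, $\mathrm{id}\in\mathcal R''$, and $\mathcal R''\cdot x_0$ and $\mathcal G\cdot x_0$ have the same affine hull. Let $U_{\rm iso}(\mathcal R)$ (resp. $U_{{\rm iso},0,0}(\mathcal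 R)$) be the space of all $u\colon\mathcal R\to\mathbb R^d$ for which there are $a\in\mathbb R^d$ and a skew symmetric $S\in\mathbb R^{d\times d}$ (resp. such an $S$ of the form $S_1\oplus 0$ with $S_1\in\mathbb R^{d_1\times d_1}$) with $\mathrm{rot}(g)u(g)=a+S(g\cdot x_0-x_0)$ for all $g\in\mathcal R$. Let $P$ (resp. $P_0$) be the orthogonal projection of $(\mathbb R^d)^{\mathcal R}$ with kernel $U_{\rm iso}(\mathcal R)$ (resp. $U_{{\rm iso},0,0}(\mathcal R)$). For a $\mathcal T^N$-periodic $u\in U_{\rm per}$ put $$\|u\|_{\mathcal R}=\Big(\tfrac1{|\mathcal C_N|}\sum_{g\in\mathcal C_N}\big\|P\,(u(gh))_{h\in\mathcal R}\big\|^2\Big)^{1/2},$$ and define $\|u\|_{\mathcal R,0,0}$ likewise with $P_0$. In $[-\infty,\infty]$ let $$\lambda_a=\sup\{c\in\mathbb R:\ c\|u\|_{\mathcal R}^2\le E''(x_0)(u,u)\ \ \forall u\in U_{\rm per}\},$$ $$\lambda_{a,0,0}=\sup\{c\in\mathbb R:\ c\|u\|_{\mathcal R,0,0}^2\le E''(x_0)(u,u)\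 \ \forall u\in U_{\rm per}\}.$$ **Fourier side.** Define $f_V\colon\mathcal G\to\mathbb R^{d\times d}$ by $$f_V(g)=\sum_{h_1,h_2\in\mathcal G^*}\Big(\delta_{g,h_2^{-1}h_1}\mathrm{rot}(h_2)^{\mathsf T}H_{h_2h_1}\mathrm{rot}(h_1)-\delta_{g,h_2^{-1}}\mathrm{rot}(h_2)^{\mathsf T}H_{h_2h_1}-\delta_{g,h_1}H_{h_2h_1}\mathrm{rot}(h_1)+\delta_{g,\mathrm{id}}H_{h_2h_1}\Big),$$ where $H_{h_2h_1}=\partial_{h_2}\partial_{h_1}V(y_0)$, and $g_{\mathcal R}(g)=P(\delta_{g,h}I_d)_{h\in\mathcal R}$, $g_{\mathcal R,0,0}(g)=P_0(\delta_{g,h}I_d)_{h\in\mathcal R}$, both in $\mathbb R^{(d|\mathcal R|)\times d}$. For a summable matrix function $u$ on $\mathcal G$ and a unitary representation $\rho\colon\mathcal G\to \mathrm U(d_\rho)$ let $\hat u(\rho)=\sum_{g\in\mathcal G}u(g)\otimes\rho(g)$, with the Kronecker product. For a Hermitian $A\in\mathbb C^{n\times n}$ and $B\in\mathbb C^{m\times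 n}$ let $\lambda_{\min}(A,B)=\sup\{c\in\mathbb R: A-cB^{\mathsf H}B\text{ is positive semidefinite}\}\in[-\infty,\infty]$. Let $\mathcal E$ be a set of representatives of the unitary equivalence classes of periodic irreducible unitary representations of $\mathcal G$. **Theorem.** In $[-\infty,\infty]$ we have $$\lambda_a=\inf_{\rho\in\mathcal E}\lambda_{\min}\big(\hat f_V(\rho),\hat g_{\mathcal R}(\rho)\big)\qquad\text{and}\qquad\lambda_{a,0,0}=\inf_{\rho\in\mathcal E}\lambda_{\min}\big(\hat f_V(\rho),\hat g_{\mathcal R,0,0}(\rho)\big).$$ -/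

import Mathlib

open scoped ComplexOrder ENNReal Kronecker Matrix Pointwise

noncomputable section

namespace Objective

/-- The Euclidean space with coordinates indexed by `ι`. -/
abbrev Eu (ι : Type) : Type := EuclideanSpace ℝ ι

/-- The Euclidean group: all isometries of the Euclidean space. -/
abbrev EucGroup (ι : Type) [Fintype ι] : Type := Eu ι ≃ᵃⁱ[ℝ] Eu ι

/-- The orthogonal group. -/
abbrev OrthGroup (ι : Type) [Fintype ι] : Type := Eu ι ≃ₗᵢ[ℝ] Eu ι

/-- The matrix of the linear component of a Euclidean isometry. -/
def rot {ι : Type} [Fintype ι] [DecidableEq ι] (g : EucGroup ι) : Matrix ι ι ℝ :=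
  Matrix.of fun i j => g.linearIsometryEquiv (EuclideanSpace.single j 1) i

/-- Every orbit of the group is a discrete set. -/
def IsDiscreteGroup {ι : Type} [Fintype ι] (G : Subgroup (EucGroup ι)) : Prop :=
  ∀ x : Eu ι, DiscreteTopology ((fun g : EucGroup ι => g x) '' (G : Set (EucGroup ι)))

/-- A space group: discrete, containing translations along a basis. -/
def IsSpaceGroup {n : ℕ} (S : Subgroup (EucGroup (Fin n))) : Prop :=
  IsDiscreteGroup S ∧
    ∃ b : Fin n → Eu (Fin n), LinearIndependent ℝ b ∧
      ∀ i, AffineIsometryEquiv.constVAdd ℝ (Eu (Fin n)) (b i) ∈ S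

section Block

variable {d₁ d₂ : ℕ}

/-- The first `d₁` coordinates. -/
def fstPart (x : Eu (Fin d₁ ⊕ Fin d₂)) : Eu (Fin d₁) := WithLp.toLp 2 fun i => x (Sum.inl i)

/-- The last `d₂` coordinates. -/
def sndPart (x : Eu (Fin d₁ ⊕ Fin d₂)) : Eu (Fin d₂) := WithLp.toLp 2 fun i => x (Sum.inr i)

/-- The vector with given first `d₁` and last `d₂` coordinates. -/
def joinPart (a : Eu (Fin d₁)) (b : Eu (Fin d₂)) : Eu (Fin d₁ ⊕ Fin d₂) :=
  WithLp.toLp 2 (Sum.elim (fun i => a i) (fun i => b i))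

@[simp] theorem fstPart_joinPart (a : Eu (Fin d₁)) (b : Eu (Fin d₂)) :
    fstPart (joinPart a b) = a := rfl

@[simp] theorem sndPart_joinPart (a : Eu (Fin d₁)) (b : Eu (Fin d₂)) :
    sndPart (joinPart a b) = b := rfl

@[simp] theorem joinPart_parts (x : Eu (Fin d₁ ⊕ Fin d₂)) :
    joinPart (fstPart x) (sndPart x) = x := by
  ext i
  cases i <;> rfl

theorem norm_sq_joinPart (a : Eu (Fin d₁)) (b : Eu (Fin d₂)) :
    ‖joinPart a b‖ ^ 2 = ‖a‖ ^ 2 + ‖b‖ ^ 2 := by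
  simp [EuclideanSpace.norm_sq_eq, Fintype.sum_sum_type, joinPart]

/-- The block diagonal orthogonal map `B₁ ⊕ B₂`. -/
def blockLinear (B₁ : OrthGroup (Fin d₁)) (B₂ : OrthGroup (Fin d₂)) :
    OrthGroup (Fin d₁ ⊕ Fin d₂) where
  toFun x := joinPart (B₁ (fstPart x)) (B₂ (sndPart x))
  invFun x := joinPart (B₁.symm (fstPart x)) (B₂.symm (sndPart x))
  map_add' x y := by
    have h₁ : fstPart (x + y) = fstPart x + fstPart y := rfl
    have h₂ : sndPart (x + y) = sndPart x + sndPart y := rfl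
    ext i
    cases i <;> simp [h₁, h₂, joinPart]
  map_smul' c x := by
    have h₁ : fstPart (c • x) = c • fstPart x := rfl
    have h₂ : sndPart (c • x) = c • sndPart x := rfl
    ext i
    cases i <;> simp [h₁, h₂, joinPart]
  left_inv x := by simp
  right_inv x := by simp
  norm_map' x := by
    change ‖joinPart (B₁ (fstPart x)) (B₂ (sndPart x))‖ = ‖x‖
    rw [← sq_eq_sq₀ (norm_nonneg _) (norm_nonneg _), norm_sq_joinPart]
    conv_rhs => rw [← joinPart_parts x, norm_sq_joinPart]
    simp

/-- The isometry `A ⊕ h` with linear part `A ⊕ rot h` and translation part `(0, h 0)`. -/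
def blockIso (A : OrthGroup (Fin d₁)) (h : EucGroup (Fin d₂)) : EucGroup (Fin d₁ ⊕ Fin d₂) :=
  (blockLinear A h.linearIsometryEquiv).toAffineIsometryEquiv.trans
    (AffineIsometryEquiv.constVAdd ℝ (Eu (Fin d₁ ⊕ Fin d₂)) (joinPart 0 (h 0)))

theorem blockIso_apply (A : OrthGroup (Fin d₁)) (h : EucGroup (Fin d₂))
    (x : Eu (Fin d₁ ⊕ Fin d₂)) :
    blockIso A h x = joinPart (A (fstPart x)) (h (sndPart x)) := by
  have key : h (sndPart x) = h.linearIsometryEquiv (sndPart x) + h 0 := by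
    have := h.map_vadd 0 (sndPart x)
    simpa using this
  change joinPart 0 (h 0) + joinPart (A (fstPart x)) (h.linearIsometryEquiv (sndPart x)) = _
  rw [key]
  ext i
  cases i <;> simp [joinPart, add_comm]

/-- The group homomorphism `O(d₁) × E(d₂) → E(d₁ + d₂)`, `(A, h) ↦ A ⊕ h`. -/
def gplus : OrthGroup (Fin d₁) × EucGroup (Fin d₂) →* EucGroup (Fin d₁ ⊕ Fin d₂) where
  toFun p := blockIso p.1 p.2
  map_one' := by
    refine AffineIsometryEquiv.ext fun x => ?_
    simp [blockIso_apply]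
  map_mul' p q := by
    refine AffineIsometryEquiv.ext fun x => ?_
    simp [blockIso_apply]

/-- The image of `G` under the projection `π : A ⊕ h ↦ h`. -/
def spacePart (G : Subgroup (EucGroup (Fin d₁ ⊕ Fin d₂))) : Subgroup (EucGroup (Fin d₂)) :=
  (G.comap gplus).map (MonoidHom.snd _ _)

/-- A discrete group `G < O(d₁) ⊕ S` with `π(G) = S` for a `d₂`-dimensional space group `S`. -/
structure IsStandardDiscrete (G : Subgroup (EucGroup (Fin d₁ ⊕ Fin d₂))) : Prop where
  discrete : IsDiscreteGroup G
  block : G ≤ (gplus (d₁ := d₁) (d₂ := d₂)).range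
  space : IsSpaceGroup (spacePart G)

/-- `T ⊆ G` is mapped bijectively by `π` onto the set of translations of the space group `π(G)`. -/
def IsTranslationSection (G : Subgroup (EucGroup (Fin d₁ ⊕ Fin d₂))) (T : Set G) : Prop :=
  (∀ t ∈ T, ∃ (A : OrthGroup (Fin d₁)) (b : Eu (Fin d₂)),
    (t : EucGroup (Fin d₁ ⊕ Fin d₂)) =
      gplus (A, AffineIsometryEquiv.constVAdd ℝ (Eu (Fin d₂)) b)) ∧
  ∀ b : Eu (Fin d₂), AffineIsometryEquiv.constVAdd ℝ (Eu (Fin d₂)) b ∈ spacePart G →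
    ∃! t : G, t ∈ T ∧ ∃ A : OrthGroup (Fin d₁),
      (t : EucGroup (Fin d₁ ⊕ Fin d₂)) =
        gplus (A, AffineIsometryEquiv.constVAdd ℝ (Eu (Fin d₂)) b)

end Block

section Periodic

variable {Γ : Type} [Group Γ]

/-- The set `{t ^ N | t ∈ T}`. -/
def powSet (T : Set Γ) (N : ℕ) : Set Γ := (fun t => t ^ N) '' T

/-- The subgroup generated by `powSet T N`; for `N ∈ periods T` it is `powSet T N` itself. -/
def powSubgroup (T : Set Γ) (N : ℕ) : Subgroup Γ := Subgroup.closure (powSet T N)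

/-- The positive `N` for which `{t ^ N | t ∈ T}` is a normal subgroup. -/
def periods (T : Set Γ) : Set ℕ :=
  {N | 0 < N ∧ ∃ H : Subgroup Γ, H.Normal ∧ (H : Set Γ) = powSet T N}

/-- `u (g t) = u g` for all `g` and all `t ∈ {s ^ N | s ∈ T}`. -/
def IsPeriodicWith {X : Type*} (T : Set Γ) (N : ℕ) (u : Γ → X) : Prop :=
  ∀ g, ∀ t ∈ powSet T N, u (g * t) = u g

/-- Periodic functions on the group. -/
def IsPeriodic {X : Type*} (T : Set Γ) (u : Γ → X) : Prop :=
  ∃ N ∈ periods T, IsPeriodicWith T N u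

open Classical in
/-- A period of a periodic function. -/
def period {X : Type*} (T : Set Γ) (u : Γ → X) : ℕ :=
  if h : IsPeriodic T u then h.choose else 0

/-- The mean of `F` over a set of representatives of the cosets of `powSubgroup T N`. -/
def cosetMean (T : Set Γ) (N : ℕ) (F : Γ → ℝ) : ℝ :=
  (Nat.card (Γ ⧸ powSubgroup T N) : ℝ)⁻¹ * ∑ᶠ q : Γ ⧸ powSubgroup T N, F q.out

/-- Unitary matrix representations of the group. -/
abbrev UnitaryRep (Γ : Type) [Group Γ] (n : ℕ) : Type := Γ →* Matrix.unitaryGroup (Fin n) ℂ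

/-- Nonzero, and without proper nonzero invariant subspaces. -/
def IsIrred {n : ℕ} (ρ : UnitaryRep Γ n) : Prop :=
  0 < n ∧ ∀ W : Submodule ℂ (Fin n → ℂ),
    (∀ g, ∀ w ∈ W, (ρ g : Matrix (Fin n) (Fin n) ℂ) *ᵥ w ∈ W) → W = ⊥ ∨ W = ⊤

/-- Unitary equivalence of representations. -/
def RepEquiv {n m : ℕ} (ρ : UnitaryRep Γ n) (σ : UnitaryRep Γ m) : Prop :=
  n = m ∧ ∃ U : Matrix (Fin n) (Fin m) ℂ, Uᴴ * U = 1 ∧ U * Uᴴ = 1 ∧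
    ∀ g, Uᴴ * (ρ g : Matrix (Fin n) (Fin n) ℂ) * U = (σ g : Matrix (Fin m) (Fin m) ℂ)

/-- `R` contains exactly one element of each equivalence class of periodic irreducible unitary
representations, and nothing else. -/
def IsPeriodicDualSet (T : Set Γ) (R : Set (Σ n : ℕ, UnitaryRep Γ n)) : Prop :=
  (∀ ρ ∈ R, IsIrred ρ.2 ∧ IsPeriodic T ρ.2) ∧
  ∀ (n : ℕ) (σ : UnitaryRep Γ n), IsIrred σ → IsPeriodic T σ → ∃! ρ, ρ ∈ R ∧ RepEquiv ρ.2 σ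

/-- The Fourier transform `∑ g, u g ⊗ ρ g` of a real summable matrix function. -/
def fourier {κ ι : Type} (u : Γ → Matrix κ ι ℝ) {n : ℕ} (ρ : UnitaryRep Γ n) :
    Matrix (κ × Fin n) (ι × Fin n) ℂ :=
  ∑' g : Γ, ((u g).map fun x : ℝ => (x : ℂ)) ⊗ₖ (ρ g : Matrix (Fin n) (Fin n) ℂ)

end Periodic

/-- The largest `c` with `c BᴴB ≤ A` in the Loewner order, as an extended real number. -/
def lambdaMin {κ ι : Type} [Fintype κ] (A : Matrix ι ι ℂ) (B : Matrix κ ι ℂ) : EReal :=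
  sSup ((fun c : ℝ => (c : EReal)) '' {c : ℝ | (A - (c : ℂ) • (Bᴴ * B)).PosSemidef})

/-- The Frobenius norm. -/
def frobNorm {ι : Type} [Fintype ι] (A : Matrix ι ι ℝ) : ℝ := √(∑ i, ∑ j, A i j ^ 2)

section Structure

variable {d₁ d₂ : ℕ} (G : Subgroup (EucGroup (Fin d₁ ⊕ Fin d₂)))

/-- `G` without the identity. -/
abbrev Punct : Type := {g : G // g ≠ 1}

/-- Bounded functions `G ∖ {id} → ℝᵈ` with the uniform norm. -/
abbrev BddPunct : Type := lp (fun _ : Punct G => Eu (Fin d₁ ⊕ Fin d₂)) ∞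

/-- The reference configuration `(g x₀ - x₀)`, `g ∈ G ∖ {id}`. -/
def refConf (x₀ : Eu (Fin d₁ ⊕ Fin d₂)) : Punct G → Eu (Fin d₁ ⊕ Fin d₂) :=
  fun g => g.1.1 x₀ - x₀

variable {G}

/-- The first derivative `V'(y)` on bounded functions. -/
def potD1 (V : (Punct G → Eu (Fin d₁ ⊕ Fin d₂)) → ℝ) (y : Punct G → Eu (Fin d₁ ⊕ Fin d₂)) :
    BddPunct G →L[ℝ] ℝ :=
  fderiv ℝ (fun z : BddPunct G => V (y + ⇑z)) 0

/-- The second derivative `V''(y)` on bounded functions. -/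
def potD2 (V : (Punct G → Eu (Fin d₁ ⊕ Fin d₂)) → ℝ) (y : Punct G → Eu (Fin d₁ ⊕ Fin d₂)) :
    BddPunct G →L[ℝ] BddPunct G →L[ℝ] ℝ :=
  fderiv ℝ (fderiv ℝ (fun z : BddPunct G => V (y + ⇑z))) 0

open Classical in
/-- The function `δ_g e_i`. -/
def unitAt (g : Punct G) (i : Fin d₁ ⊕ Fin d₂) : BddPunct G :=
  lp.single ∞ g (EuclideanSpace.single i (1 : ℝ))

/-- The partial Jacobian `∂_g V(y)`. -/
def partialJac (V : (Punct G → Eu (Fin d₁ ⊕ Fin d₂)) → ℝ)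
    (y : Punct G → Eu (Fin d₁ ⊕ Fin d₂)) (g : Punct G) : Eu (Fin d₁ ⊕ Fin d₂) :=
  WithLp.toLp 2 fun i => potD1 V y (unitAt g i)

/-- The partial Hessian `∂_g ∂_h V(y)`. -/
def partialHess (V : (Punct G → Eu (Fin d₁ ⊕ Fin d₂)) → ℝ)
    (y : Punct G → Eu (Fin d₁ ⊕ Fin d₂)) (g h : Punct G) :
    Matrix (Fin d₁ ⊕ Fin d₂) (Fin d₁ ⊕ Fin d₂) ℝ :=
  Matrix.of fun i j => potD2 V y (unitAt g i) (unitAt h j)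

/-- Interaction potentials: invariance under the orthogonal group, smoothness, summability. -/
structure IsPotential (V : (Punct G → Eu (Fin d₁ ⊕ Fin d₂)) → ℝ) : Prop where
  invariant : ∀ (B : OrthGroup (Fin d₁ ⊕ Fin d₂)) (y : Punct G → Eu (Fin d₁ ⊕ Fin d₂)),
    V (fun g => B (y g)) = V y
  smooth : ∀ y : Punct G → Eu (Fin d₁ ⊕ Fin d₂),
    ContDiff ℝ 2 (fun z : BddPunct G => V (y + ⇑z))
  summable_jac : ∀ y : Punct G → Eu (Fin d₁ ⊕ Fin d₂),
    Summable fun g : Punct G => ‖partialJac V y g‖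
  summable_hess : ∀ y : Punct G → Eu (Fin d₁ ⊕ Fin d₂),
    Summable fun p : Punct G × Punct G => frobNorm (partialHess V y p.1 p.2)

/-- `V''(y)(z₁, z₂) = ∑_{g,h} z₁(g)ᵀ ∂_g ∂_h V(y) z₂(h)` for all bounded `z₁`, `z₂`. -/
def HessianIsSum (V : (Punct G → Eu (Fin d₁ ⊕ Fin d₂)) → ℝ)
    (y : Punct G → Eu (Fin d₁ ⊕ Fin d₂)) : Prop :=
  ∀ z₁ z₂ : BddPunct G,
    HasSum (fun p : Punct G × Punct G =>
      (fun i => z₁ p.1 i) ⬝ᵥ (partialHess V y p.1 p.2 *ᵥ fun j => z₂ p.2 j)) (potD2 V y z₁ z₂)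

/-- The space of periodic functions `G → ℝᵈ` with the uniform norm. Periodic functions are bounded
and form a linear subspace, so that taking the span does not add any element. -/
def Uper (T : Set G) : Submodule ℝ (lp (fun _ : G => Eu (Fin d₁ ⊕ Fin d₂)) ∞) :=
  Submodule.span ℝ {u | IsPeriodic T (⇑u : G → Eu (Fin d₁ ⊕ Fin d₂))}

/-- The configurational energy of a periodic function `w`. -/
def energy (T : Set G) (V : (Punct G → Eu (Fin d₁ ⊕ Fin d₂)) → ℝ)
    (w : G → Eu (Fin d₁ ⊕ Fin d₂)) : ℝ :=
  cosetMean T (period T w) fun g =>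
    V fun h => (g * h.1).1 (w (g * h.1)) - g.1 (w g)

/-- The second Fréchet derivative, with respect to the uniform norm on periodic functions, of the
energy at the constant function `x₀`. -/
def energyHess (T : Set G) (V : (Punct G → Eu (Fin d₁ ⊕ Fin d₂)) → ℝ)
    (x₀ : Eu (Fin d₁ ⊕ Fin d₂)) : Uper T →L[ℝ] Uper T →L[ℝ] ℝ :=
  fderiv ℝ (fderiv ℝ fun u : Uper T => energy T V fun g => x₀ + u.1 g) 0

/-- Functions `R → ℝᵈ` with the Euclidean norm. -/
abbrev Loc (R : Finset G) : Type := PiLp 2 fun _ : R => Eu (Fin d₁ ⊕ Fin d₂)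

/-- Skew symmetric matrices. -/
def skew : Submodule ℝ (Matrix (Fin d₁ ⊕ Fin d₂) (Fin d₁ ⊕ Fin d₂) ℝ) where
  carrier := {S | Sᵀ = -S}
  add_mem' {a b} ha hb := by
    change aᵀ = -a at ha
    change bᵀ = -b at hb
    change (a + b)ᵀ = -(a + b)
    rw [Matrix.transpose_add, ha, hb, neg_add]
  zero_mem' := by simp
  smul_mem' c a ha := by
    change aᵀ = -a at ha
    change (c • a)ᵀ = -(c • a)
    rw [Matrix.transpose_smul, ha, smul_neg]

/-- Skew symmetric matrices of the form `S₁ ⊕ 0` with `S₁` of order `d₁`. -/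
def skew00 : Submodule ℝ (Matrix (Fin d₁ ⊕ Fin d₂) (Fin d₁ ⊕ Fin d₂) ℝ) where
  carrier := {S | S ∈ skew ∧ (∀ i j, S (Sum.inl i) (Sum.inr j) = 0) ∧
    ∀ i j, S (Sum.inr i) (Sum.inr j) = 0}
  add_mem' {a b} ha hb :=
    ⟨skew.add_mem ha.1 hb.1, fun i j => by simp [ha.2.1 i j, hb.2.1 i j],
      fun i j => by simp [ha.2.2 i j, hb.2.2 i j]⟩
  zero_mem' := ⟨skew.zero_mem, by simp, by simp⟩
  smul_mem' c a ha :=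
    ⟨skew.smul_mem c ha.1, fun i j => by simp [ha.2.1 i j], fun i j => by simp [ha.2.2 i j]⟩

/-- `{u : R → ℝᵈ | ∃ a, ∀ g ∈ R, rot(g) u(g) = a}`. -/
def Utrans (R : Finset G) : Submodule ℝ (Loc R) where
  carrier := {u | ∃ a : Eu (Fin d₁ ⊕ Fin d₂), ∀ g : R, g.1.1.linearIsometryEquiv (u g) = a}
  add_mem' := by
    rintro u v ⟨a, ha⟩ ⟨b, hb⟩
    exact ⟨a + b, fun g => by simp [ha g, hb g]⟩
  zero_mem' := ⟨0, fun g => by simp⟩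
  smul_mem' := by
    rintro c u ⟨a, ha⟩
    exact ⟨c • a, fun g => by simp [ha g]⟩

/-- `{u : R → ℝᵈ | ∃ S ∈ K, ∀ g ∈ R, rot(g) u(g) = S (g x₀ - x₀)}`. -/
def Urot (K : Submodule ℝ (Matrix (Fin d₁ ⊕ Fin d₂) (Fin d₁ ⊕ Fin d₂) ℝ))
    (x₀ : Eu (Fin d₁ ⊕ Fin d₂)) (R : Finset G) : Submodule ℝ (Loc R) where
  carrier := {u | ∃ S ∈ K, ∀ g : R,
    g.1.1.linearIsometryEquiv (u g) = Matrix.toEuclideanLin S (g.1.1 x₀ - x₀)}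
  add_mem' := by
    rintro u v ⟨a, ha, hu⟩ ⟨b, hb, hv⟩
    refine ⟨a + b, K.add_mem ha hb, fun g => ?_⟩
    rw [map_add, LinearMap.add_apply, ← hu g, ← hv g, ← map_add]
    rfl
  zero_mem' := ⟨0, K.zero_mem, fun g => by simp⟩
  smul_mem' := by
    rintro c u ⟨a, ha, hu⟩
    refine ⟨c • a, K.smul_mem c ha, fun g => ?_⟩
    rw [map_smul, LinearMap.smul_apply, ← hu g, ← map_smul]
    rfl

/-- Infinitesimally rigid displacements of `R` with rotational part in `K`. -/
def Uiso (K : Submodule ℝ (Matrix (Fin d₁ ⊕ Fin d₂) (Fin d₁ ⊕ Fin d₂) ℝ))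
    (x₀ : Eu (Fin d₁ ⊕ Fin d₂)) (R : Finset G) : Submodule ℝ (Loc R) :=
  Utrans R ⊔ Urot K x₀ R

/-- The orthogonal projection with kernel `Uiso K x₀ R`. -/
def isoProj (K : Submodule ℝ (Matrix (Fin d₁ ⊕ Fin d₂) (Fin d₁ ⊕ Fin d₂) ℝ))
    (x₀ : Eu (Fin d₁ ⊕ Fin d₂)) (R : Finset G) : Loc R →L[ℝ] Loc R :=
  (Uiso K x₀ R)ᗮ.starProjection

/-- The local rigidity seminorm of a periodic function. -/
def rigSeminorm (K : Submodule ℝ (Matrix (Fin d₁ ⊕ Fin d₂) (Fin d₁ ⊕ Fin d₂) ℝ))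
    (T : Set G) (x₀ : Eu (Fin d₁ ⊕ Fin d₂)) (R : Finset G)
    (u : G → Eu (Fin d₁ ⊕ Fin d₂)) : ℝ :=
  √(cosetMean T (period T u) fun g =>
    ‖isoProj K x₀ R (WithLp.toLp 2 fun h : R => u (g * h.1))‖ ^ 2)

/-- The largest `c` with `c ‖u‖² ≤ E''(u, u)` for all periodic `u`, where `‖·‖` is the rigidity
seminorm for the rotational parts `K`, as an extended real number. -/
def stabConst (K : Submodule ℝ (Matrix (Fin d₁ ⊕ Fin d₂) (Fin d₁ ⊕ Fin d₂) ℝ))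
    (T : Set G) (V : (Punct G → Eu (Fin d₁ ⊕ Fin d₂)) → ℝ)
    (x₀ : Eu (Fin d₁ ⊕ Fin d₂)) (R : Finset G) : EReal :=
  sSup ((fun c : ℝ => (c : EReal)) ''
    {c : ℝ | ∀ u : Uper T, c * rigSeminorm K T x₀ R (⇑u.1) ^ 2 ≤ energyHess T V x₀ u u})

/-- The stability constant with respect to all infinitesimal rigid motions. -/
def lambdaA (T : Set G) (V : (Punct G → Eu (Fin d₁ ⊕ Fin d₂)) → ℝ)
    (x₀ : Eu (Fin d₁ ⊕ Fin d₂)) (R : Finset G) : EReal :=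
  stabConst skew T V x₀ R

/-- The stability constant with respect to the rigid motions with linear part in `skew00`. -/
def lambdaA00 (T : Set G) (V : (Punct G → Eu (Fin d₁ ⊕ Fin d₂)) → ℝ)
    (x₀ : Eu (Fin d₁ ⊕ Fin d₂)) (R : Finset G) : EReal :=
  stabConst skew00 T V x₀ R

open Classical in
/-- The function `f_V`. -/
def fV (V : (Punct G → Eu (Fin d₁ ⊕ Fin d₂)) → ℝ) (x₀ : Eu (Fin d₁ ⊕ Fin d₂)) (g : G) :
    Matrix (Fin d₁ ⊕ Fin d₂) (Fin d₁ ⊕ Fin d₂) ℝ :=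
  ∑' p : Punct G × Punct G,
    let h₁ := p.1
    let h₂ := p.2
    let H := partialHess V (refConf G x₀) h₂ h₁
    ((if g = h₂.1⁻¹ * h₁.1 then (rot h₂.1.1)ᵀ * H * rot h₁.1.1 else 0)
      - (if g = h₂.1⁻¹ then (rot h₂.1.1)ᵀ * H else 0)
      - (if g = h₁.1 then H * rot h₁.1.1 else 0)
      + (if g = 1 then H else 0))

open Classical in
/-- The matrix of the orthogonal projection `isoProj`; rows and columns are indexed by
`R × {1, …, d}`. -/
def projMatrix (K : Submodule ℝ (Matrix (Fin d₁ ⊕ Fin d₂) (Fin d₁ ⊕ Fin d₂) ℝ))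
    (x₀ : Eu (Fin d₁ ⊕ Fin d₂)) (R : Finset G) :
    Matrix (R × (Fin d₁ ⊕ Fin d₂)) (R × (Fin d₁ ⊕ Fin d₂)) ℝ :=
  Matrix.of fun a b =>
    isoProj K x₀ R (WithLp.toLp 2 (Pi.single b.1 (EuclideanSpace.single b.2 1))) a.1 a.2

open Classical in
/-- The function `g ↦ P (δ_{g,h} I_d)_{h ∈ R}`, with `P` the matrix of `isoProj K x₀ R`. -/
def gProj (K : Submodule ℝ (Matrix (Fin d₁ ⊕ Fin d₂) (Fin d₁ ⊕ Fin d₂) ℝ))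
    (x₀ : Eu (Fin d₁ ⊕ Fin d₂)) (R : Finset G) (g : G) :
    Matrix (R × (Fin d₁ ⊕ Fin d₂)) (Fin d₁ ⊕ Fin d₂) ℝ :=
  projMatrix K x₀ R * Matrix.of fun (a : R × (Fin d₁ ⊕ Fin d₂)) (j : Fin d₁ ⊕ Fin d₂) =>
    if g = a.1.1 ∧ a.2 = j then (1 : ℝ) else 0

/-- The function `g_R`. -/
def gR (x₀ : Eu (Fin d₁ ⊕ Fin d₂)) (R : Finset G) :
    G → Matrix (R × (Fin d₁ ⊕ Fin d₂)) (Fin d₁ ⊕ Fin d₂) ℝ :=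
  gProj skew x₀ R

/-- The function `g_{R,0,0}`. -/
def gR00 (x₀ : Eu (Fin d₁ ⊕ Fin d₂)) (R : Finset G) :
    G → Matrix (R × (Fin d₁ ⊕ Fin d₂)) (Fin d₁ ⊕ Fin d₂) ℝ :=
  gProj skew00 x₀ R

/-- The orbit of `x₀` under the elements of `R`. -/
def orbitOf (x₀ : Eu (Fin d₁ ⊕ Fin d₂)) (R : Set G) : Set (Eu (Fin d₁ ⊕ Fin d₂)) :=
  (fun g : G => g.1 x₀) '' R

/-- Property 1: finite, contains the identity, and `aff(R x₀) = aff(G x₀)`. -/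
def Property1 (x₀ : Eu (Fin d₁ ⊕ Fin d₂)) (R : Set G) : Prop :=
  R.Finite ∧ 1 ∈ R ∧
    affineSpan ℝ (orbitOf x₀ R) = affineSpan ℝ (orbitOf x₀ (Set.univ : Set G))

/-- Property 2: finite, and contains a product `R' R''` where `R'` contains the identity and
generates `G`, and `R''` has Property 1. -/
def Property2 (x₀ : Eu (Fin d₁ ⊕ Fin d₂)) (R : Set G) : Prop :=
  R.Finite ∧ ∃ R' R'' : Set G, 1 ∈ R' ∧ Subgroup.closure R' = ⊤ ∧ Property1 x₀ R'' ∧ R' * R'' ⊆ R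

end Structure

end Objective

end

/-! For a real `c` and a unitary representation `ρ`, let `S_c(ρ) = f̂(ρ) - c ĝ(ρ)ᴴ ĝ(ρ)`
(`stabMatrix`), with `f = f_V` and `g` the projection function. Both identities follow from one
equivalence (`stability_iff`): `c‖u‖² ≤ E''(u,u)` for all periodic `u` if and only if `S_c(ρ)` is
positive semidefinite for all `ρ` in the dual set. Each of these conditions on `c` is stable under
decreasing `c`, so the supremum of the intersection is the infimum of the suprema
(`sSup_image_coe_forall_mem`).

The link is the right regular representation of the finite group `G / T^N` (`regRep`). A
`T^N`-periodic `u` is a vector indexed by cosets and coordinates, and on such vectors `A ⊗ reg(k)`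
acts by `u ↦ A u(· k)`. Orthogonal invariance of `V` turns the energy into the mean of `V(y₀ + z_g)`
with `z_g(h) = rot(h) u(gh) - u(g)` (`potential_conf_eq`), so `E''(u,u)` is the mean of
`V''(y₀)(z_g, z_g)` (`energyHess_apply`). On the Fourier side `f̂(ρ)` factors as the sum of
`(rot(h₂) ⊗ ρ(h₂) - 1)ᴴ (H ⊗ 1) (rot(h₁) ⊗ ρ(h₁) - 1)` (`hasSum_fourier_fV`), and for the regular
representation these factors send `u` to its relative displacements. Hence the quadratic form of
`S_c(reg)` at `u` is `|G / T^N| (E''(u,u) - c‖u‖²)` (`stabMatrix_quadratic`). Since `S_c(reg)` is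
real, testing real `u` is enough.

It remains to compare the regular representation with the irreducible ones. Fourier transforms
commute with intertwiners, hence so does `S_c` (`stabMatrix_mul_intertwiner`), and positivity passes
along them. Matrix coefficients embed each representation of the quotient into copies of the regular
one (`PosSemidef_stabMatrix_of_regRep`); conversely, the regular representation splits orthogonally
into irreducibles (`PosSemidef_stabMatrix_of_dualSet`). -/

noncomputable section

namespace Objective

/-! ### Fourier transforms and intertwiners. -/

section Fourier

variable {Γ : Type} [Group Γ] {κ ι : Type}

theorem _root_.HasSum.matrix_mul_left {α l m n : Type*} [Fintype m] {f : α → Matrix m n ℂ}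
    {a : Matrix m n ℂ} (h : HasSum f a) (X : Matrix l m ℂ) :
    HasSum (fun x => X * f x) (X * a) :=
  h.map (AddMonoidHom.mk' (fun M : Matrix m n ℂ => X * M) (Matrix.mul_add X))
    (continuous_const.matrix_mul continuous_id)

theorem _root_.HasSum.matrix_mul_right {α l m n : Type*} [Fintype m] {f : α → Matrix l m ℂ}
    {a : Matrix l m ℂ} (h : HasSum f a) (X : Matrix m n ℂ) :
    HasSum (fun x => f x * X) (a * X) :=
  h.map (AddMonoidHom.mk' (fun M : Matrix l m ℂ => M * X) fun A B => Matrix.add_mul A B X)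
    (continuous_id.matrix_mul continuous_const)

theorem norm_unitaryRep_apply_le_one {n : ℕ} (ρ : UnitaryRep Γ n) (g : Γ) (i j : Fin n) :
    ‖(ρ g).1 i j‖ ≤ 1 :=
  entry_norm_bound_of_unitary (ρ g).2 i j

theorem unitaryRep_mul {n : ℕ} (ρ : UnitaryRep Γ n) (g h : Γ) :
    (ρ (g * h)).1 = (ρ g).1 * (ρ h).1 := by
  rw [map_mul]; rfl

theorem unitaryRep_inv {n : ℕ} (ρ : UnitaryRep Γ n) (g : Γ) :
    (ρ g⁻¹).1 = (ρ g).1ᴴ := by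
  rw [map_inv]; rfl

theorem hasSum_fourier {u : Γ → Matrix κ ι ℝ} (hu : Summable u) {n : ℕ} (ρ : UnitaryRep Γ n) :
    HasSum (fun g => ((u g).map fun x : ℝ => (x : ℂ)) ⊗ₖ (ρ g).1)
      (fourier u ρ) := by
  refine Summable.hasSum ?_
  refine Pi.summable.2 fun a => Pi.summable.2 fun b => ?_
  have h := (Pi.summable.1 (Pi.summable.1 hu a.1) b.1).abs
  refine Summable.of_norm_bounded h fun g => ?_
  simp only [Matrix.kroneckerMap_apply, Matrix.map_apply, norm_mul, Complex.norm_real,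
    Real.norm_eq_abs]
  exact mul_le_of_le_one_right (abs_nonneg _) (norm_unitaryRep_apply_le_one ρ g _ _)

/-- `X` intertwines the representations `σ` and `ρ`. -/
def Intertwines {n m : ℕ} (ρ : UnitaryRep Γ n) (σ : UnitaryRep Γ m)
    (X : Matrix (Fin n) (Fin m) ℂ) : Prop :=
  ∀ g, (ρ g).1 * X = X * (σ g).1

theorem Intertwines.conjTranspose {n m : ℕ} {ρ : UnitaryRep Γ n} {σ : UnitaryRep Γ m}
    {X : Matrix (Fin n) (Fin m) ℂ} (h : Intertwines ρ σ X) : Intertwines σ ρ Xᴴ := by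
  intro g
  have := congrArg Matrix.conjTranspose (h g⁻¹)
  simpa only [Matrix.conjTranspose_mul, unitaryRep_inv, Matrix.conjTranspose_conjTranspose]
    using this.symm

/-- Termwise, `(u(g) ⊗ ρ(g)) (1 ⊗ X) = u(g) ⊗ X σ(g) = (1 ⊗ X) (u(g) ⊗ σ(g))`. No unitarity or
invertibility of `X` is needed. -/
theorem fourier_mul_intertwiner [Fintype κ] [Fintype ι] [DecidableEq κ] [DecidableEq ι]
    {u : Γ → Matrix κ ι ℝ} (hu : Summable u)
    {n m : ℕ} {ρ : UnitaryRep Γ n} {σ : UnitaryRep Γ m}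
    {X : Matrix (Fin n) (Fin m) ℂ} (h : Intertwines ρ σ X) :
    fourier u ρ * ((1 : Matrix ι ι ℂ) ⊗ₖ X) = ((1 : Matrix κ κ ℂ) ⊗ₖ X) * fourier u σ := by
  refine ((hasSum_fourier hu ρ).matrix_mul_right _).unique ?_
  convert (hasSum_fourier hu σ).matrix_mul_left ((1 : Matrix κ κ ℂ) ⊗ₖ X) using 2 with g
  rw [← Matrix.mul_kronecker_mul, ← Matrix.mul_kronecker_mul, h g, Matrix.mul_one, Matrix.one_mul]

/-- The matrix `f̂(ρ) - c ĝ(ρ)ᴴ ĝ(ρ)`. -/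
def stabMatrix [Fintype κ] (f : Γ → Matrix ι ι ℝ) (g : Γ → Matrix κ ι ℝ) (c : ℝ) {n : ℕ}
    (ρ : UnitaryRep Γ n) : Matrix (ι × Fin n) (ι × Fin n) ℂ :=
  fourier f ρ - (c : ℂ) • ((fourier g ρ)ᴴ * fourier g ρ)

variable [Fintype κ] [Fintype ι] [DecidableEq κ] [DecidableEq ι]
  {f : Γ → Matrix ι ι ℝ} {g : Γ → Matrix κ ι ℝ} {n m : ℕ} {ρ : UnitaryRep Γ n}
  {σ : UnitaryRep Γ m}

/-- To move `X` past `ĝᴴ` one uses that `Xᴴ` intertwines in the opposite direction, by unitarity,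
and takes adjoints. -/
theorem stabMatrix_mul_intertwiner (hf : Summable f) (hg : Summable g) (c : ℝ)
    {X : Matrix (Fin n) (Fin m) ℂ} (h : Intertwines ρ σ X) :
    stabMatrix f g c ρ * ((1 : Matrix ι ι ℂ) ⊗ₖ X) =
      ((1 : Matrix ι ι ℂ) ⊗ₖ X) * stabMatrix f g c σ := by
  have h1 := fourier_mul_intertwiner hf h
  have h2 := fourier_mul_intertwiner hg h
  have h3 := congrArg Matrix.conjTranspose (fourier_mul_intertwiner hg h.conjTranspose)
  simp only [Matrix.conjTranspose_mul, Matrix.conjTranspose_kronecker, Matrix.conjTranspose_one,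
    Matrix.conjTranspose_conjTranspose] at h3
  rw [stabMatrix, stabMatrix, Matrix.sub_mul, Matrix.mul_sub, h1, Matrix.smul_mul, Matrix.mul_smul,
    Matrix.mul_assoc, h2, ← Matrix.mul_assoc, ← h3, Matrix.mul_assoc]

theorem PosSemidef_stabMatrix_of_isometry (hf : Summable f) (hg : Summable g) {c : ℝ}
    {X : Matrix (Fin n) (Fin m) ℂ} (h : Intertwines ρ σ X) (hX : Xᴴ * X = 1)
    (hρ : (stabMatrix f g c ρ).PosSemidef) : (stabMatrix f g c σ).PosSemidef := by
  have h1 := hρ.conjTranspose_mul_mul_same ((1 : Matrix ι ι ℂ) ⊗ₖ X)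
  rw [Matrix.mul_assoc, stabMatrix_mul_intertwiner hf hg c h, ← Matrix.mul_assoc,
    Matrix.conjTranspose_kronecker, ← Matrix.mul_kronecker_mul, hX] at h1
  simpa using h1

/-- Pulling the intertwiners through gives `∑ (1 ⊗ X_a) S_c(τ_a) (1 ⊗ X_a)ᴴ = r S_c(ρ)`, and the
left side is positive semidefinite. It is used with `r = 1` for orthogonal decompositions and with
`r` the order of a quotient group for matrix coefficients. -/
theorem PosSemidef_stabMatrix_of_sum {α : Type*} [Fintype α] (hf : Summable f) (hg : Summable g)
    {c r : ℝ} (hr : 0 < r) {k : α → ℕ} (τ : ∀ a, UnitaryRep Γ (k a))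
    (X : ∀ a, Matrix (Fin n) (Fin (k a)) ℂ) (h : ∀ a, Intertwines ρ (τ a) (X a))
    (hX : ∑ a, X a * (X a)ᴴ = (r : ℂ) • 1)
    (hτ : ∀ a, (stabMatrix f g c (τ a)).PosSemidef) : (stabMatrix f g c ρ).PosSemidef := by
  have h1 : (∑ a, ((1 : Matrix ι ι ℂ) ⊗ₖ X a) * stabMatrix f g c (τ a) *
      ((1 : Matrix ι ι ℂ) ⊗ₖ X a)ᴴ).PosSemidef :=
    Matrix.posSemidef_sum _ fun a _ => (hτ a).mul_mul_conjTranspose_same _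
  have h2 : ∑ a, ((1 : Matrix ι ι ℂ) ⊗ₖ X a) * stabMatrix f g c (τ a) *
      ((1 : Matrix ι ι ℂ) ⊗ₖ X a)ᴴ = (r : ℂ) • stabMatrix f g c ρ := by
    have h3 : ∑ a, (1 : Matrix ι ι ℂ) ⊗ₖ (X a * (X a)ᴴ) = (r : ℂ) • 1 := by
      have : ∑ a, (1 : Matrix ι ι ℂ) ⊗ₖ (X a * (X a)ᴴ) =
          (1 : Matrix ι ι ℂ) ⊗ₖ ∑ a, X a * (X a)ᴴ :=
        (map_sum (Matrix.kroneckerBilinear (R := ℂ) (1 : Matrix ι ι ℂ)) _ _).symm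
      rw [this, hX, Matrix.kronecker_smul, Matrix.one_kronecker_one]
    calc _ = ∑ a, stabMatrix f g c ρ * ((1 : Matrix ι ι ℂ) ⊗ₖ (X a * (X a)ᴴ)) := by
          refine Finset.sum_congr rfl fun a _ => ?_
          rw [← stabMatrix_mul_intertwiner hf hg c (h a), Matrix.mul_assoc,
            Matrix.conjTranspose_kronecker, ← Matrix.mul_kronecker_mul]
          simp
      _ = _ := by rw [← Finset.mul_sum, h3]; simp
  rw [h2] at h1
  have h4 := h1.smul (a := ((r⁻¹ : ℝ) : ℂ)) (by simpa using hr.le)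
  rwa [smul_smul, ← Complex.ofReal_mul, inv_mul_cancel₀ hr.ne', Complex.ofReal_one, one_smul] at h4

end Fourier

/-! ### Orthogonal decomposition of unitary representations. -/

section Reduction

variable {Γ : Type} [Group Γ] {n : ℕ}

/-- The columns of `X` are an orthonormal basis of `W`, so `X * Xᴴ` is the orthogonal projection
onto `W`. -/
theorem exists_isometry_of_submodule (W : Submodule ℂ (Fin n → ℂ)) :
    ∃ (m : ℕ) (X : Matrix (Fin n) (Fin m) ℂ), Xᴴ * X = 1 ∧
      (∀ w ∈ W, (X * Xᴴ) *ᵥ w = w) ∧ ∀ w, (X * Xᴴ) *ᵥ w ∈ W := by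
  let e : EuclideanSpace ℂ (Fin n) ≃ₗ[ℂ] (Fin n → ℂ) := WithLp.linearEquiv 2 ℂ (Fin n → ℂ)
  let W' : Submodule ℂ (EuclideanSpace ℂ (Fin n)) := W.comap e.toLinearMap
  let b := stdOrthonormalBasis ℂ W'
  let X : Matrix (Fin n) (Fin (Module.finrank ℂ W')) ℂ :=
    Matrix.of fun i j => (b j : EuclideanSpace ℂ (Fin n)) i
  have hXX : ∀ w : Fin n → ℂ, (X * Xᴴ) *ᵥ w =
      e (∑ j, inner ℂ (b j : EuclideanSpace ℂ (Fin n)) (e.symm w) •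
        (b j : EuclideanSpace ℂ (Fin n))) := by
    intro w
    rw [← Matrix.mulVec_mulVec]
    ext i
    simp [Matrix.mulVec, dotProduct, X, e, PiLp.inner_apply, mul_comm]
  refine ⟨_, X, ?_, ?_, ?_⟩
  · ext i j
    have h := orthonormal_iff_ite.1 b.orthonormal i j
    rw [Matrix.one_apply, ← h, Submodule.coe_inner, PiLp.inner_apply]
    simp [Matrix.mul_apply, X, mul_comm]
  · intro w hw
    rw [hXX]
    have hw' : e.symm w ∈ W' := by simpa [W'] using hw
    have h := b.sum_repr' ⟨e.symm w, hw'⟩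
    have h' := congrArg (fun x : W' => e x) h
    simpa using h'
  · intro w
    rw [hXX]
    have : ∑ j, inner ℂ (b j : EuclideanSpace ℂ (Fin n)) (e.symm w) •
        (b j : EuclideanSpace ℂ (Fin n)) ∈ W' :=
      Submodule.sum_mem _ fun j _ => W'.smul_mem _ (b j).2
    exact this

/-- The restriction of `ρ` to the range of an isometry whose range projection commutes with `ρ`. -/
def subRep (ρ : UnitaryRep Γ n) {m : ℕ} (X : Matrix (Fin n) (Fin m) ℂ) (hX : Xᴴ * X = 1)
    (h : ∀ g, (ρ g).1 * (X * Xᴴ) = X * Xᴴ * (ρ g).1) : UnitaryRep Γ m :=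
  MonoidHom.mk'
    (fun g => ⟨Xᴴ * (ρ g).1 * X, by
      have h1 : (Xᴴ * (ρ g).1 * X)ᴴ * (Xᴴ * (ρ g).1 * X) = 1 := by
        have h2 : (ρ g).1ᴴ * (ρ g).1 = 1 :=
          Matrix.mem_unitaryGroup_iff'.1 (ρ g).2
        simp only [Matrix.conjTranspose_mul, Matrix.conjTranspose_conjTranspose]
        calc _ = Xᴴ * (ρ g).1ᴴ * (X * Xᴴ * (ρ g).1) * X := by
              simp only [Matrix.mul_assoc]
          _ = Xᴴ * ((ρ g).1ᴴ * (ρ g).1) * X * (Xᴴ * X) := by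
              rw [← h]; simp only [Matrix.mul_assoc]
          _ = 1 := by rw [h2, Matrix.mul_one, hX, Matrix.mul_one]
      exact Matrix.mem_unitaryGroup_iff'.2 h1⟩)
    (fun g k => by
      apply Subtype.ext
      change Xᴴ * (ρ (g * k)).1 * X = Xᴴ * (ρ g).1 * X * (Xᴴ * (ρ k).1 * X)
      calc _ = Xᴴ * (ρ g).1 * (ρ k).1 * X * (Xᴴ * X) := by
            rw [hX, unitaryRep_mul]; simp only [Matrix.mul_assoc, Matrix.mul_one]
        _ = Xᴴ * (ρ g).1 * ((ρ k).1 * (X * Xᴴ)) * X := by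
            simp only [Matrix.mul_assoc]
        _ = _ := by rw [h]; simp only [Matrix.mul_assoc])

theorem coe_subRep (ρ : UnitaryRep Γ n) {m : ℕ} (X : Matrix (Fin n) (Fin m) ℂ) (hX : Xᴴ * X = 1)
    (h : ∀ g, (ρ g).1 * (X * Xᴴ) = X * Xᴴ * (ρ g).1) (g : Γ) :
    (subRep ρ X hX h g : Matrix (Fin m) (Fin m) ℂ) = Xᴴ * (ρ g).1 * X := rfl

theorem intertwines_subRep (ρ : UnitaryRep Γ n) {m : ℕ} (X : Matrix (Fin n) (Fin m) ℂ)
    (hX : Xᴴ * X = 1)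
    (h : ∀ g, (ρ g).1 * (X * Xᴴ) = X * Xᴴ * (ρ g).1) :
    Intertwines ρ (subRep ρ X hX h) X := by
  intro g
  rw [coe_subRep, ← Matrix.mul_assoc, ← Matrix.mul_assoc, ← h, Matrix.mul_assoc, Matrix.mul_assoc,
    hX, Matrix.mul_one]

theorem eq_of_mulVec_eq {m : ℕ} {A B : Matrix (Fin m) (Fin n) ℂ} (h : ∀ w, A *ᵥ w = B *ᵥ w) :
    A = B :=
  Matrix.ext_of_mulVec_single fun _ => h _

/-- A reducible unitary representation is an orthogonal sum of two smaller ones. -/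
theorem exists_orthogonal_decomposition (ρ : UnitaryRep Γ n) (hn : 0 < n) (hρ : ¬ IsIrred ρ) :
    ∃ (k : Bool → ℕ) (τ : ∀ a, UnitaryRep Γ (k a)) (X : ∀ a, Matrix (Fin n) (Fin (k a)) ℂ),
      (∀ a, k a < n) ∧ (∀ a, (X a)ᴴ * X a = 1) ∧ (∀ a, Intertwines ρ (τ a) (X a)) ∧
      ∑ a, X a * (X a)ᴴ = 1 := by
  simp only [IsIrred, hn, true_and, not_forall, not_or] at hρ
  obtain ⟨W, hW, hbot, htop⟩ := hρ
  obtain ⟨m, X, hX, hXW, hXr⟩ := exists_isometry_of_submodule W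
  obtain ⟨P, hP⟩ : ∃ P, P = X * Xᴴ := ⟨_, rfl⟩
  rw [← hP] at hXW hXr
  have hPP : P * P = P := by
    rw [hP, Matrix.mul_assoc, ← Matrix.mul_assoc Xᴴ, hX, Matrix.one_mul]
  have hPh : Pᴴ = P := by simp [hP, Matrix.conjTranspose_mul]
  have hPρ : ∀ g, P * (ρ g).1 * P = (ρ g).1 * P := fun g =>
    eq_of_mulVec_eq fun w => by
      rw [Matrix.mul_assoc, ← Matrix.mulVec_mulVec, ← Matrix.mulVec_mulVec]
      exact hXW _ (hW g _ (hXr w))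
  -- Invariance gives `P ρ(g) P = ρ(g) P`; the adjoint of the same identity at `g⁻¹` is `P ρ(g) P =
  -- P ρ(g)`.
  have hcomm : ∀ g, (ρ g).1 * P = P * (ρ g).1 := by
    intro g
    have h := congrArg Matrix.conjTranspose (hPρ g⁻¹)
    simp only [Matrix.conjTranspose_mul, hPh, unitaryRep_inv,
      Matrix.conjTranspose_conjTranspose] at h
    rw [← hPρ g, Matrix.mul_assoc, h]
  -- Since `P` is an orthogonal projection, its kernel is the orthogonal complement of `W`.
  obtain ⟨l, Y, hY, hYW, hYr⟩ := exists_isometry_of_submodule (LinearMap.ker P.mulVecLin)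
  have hQ : Y * Yᴴ = 1 - P := by
    have h1 : (Y * Yᴴ) * (1 - P) = 1 - P := eq_of_mulVec_eq fun w => by
      rw [← Matrix.mulVec_mulVec]
      apply hYW
      simp [Matrix.mul_sub, hPP]
    have h2 : P * (Y * Yᴴ) = 0 := eq_of_mulVec_eq fun w => by
      rw [← Matrix.mulVec_mulVec]
      have := hYr w
      rw [LinearMap.mem_ker] at this
      simpa using this
    have h3 := congrArg Matrix.conjTranspose h2
    simp only [Matrix.conjTranspose_mul, hPh, Matrix.conjTranspose_conjTranspose,
      Matrix.conjTranspose_zero] at h3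
    rw [← h1, Matrix.mul_sub, h3]; simp
  -- Dimensions are read off from traces: `tr (X Xᴴ) = tr (Xᴴ X) = m`, and likewise for `Y`.
  have hcard : m + l = n := by
    have h1 : (P + (1 - P)).trace = n := by simp
    rw [Matrix.trace_add, ← hQ, hP, Matrix.trace_mul_comm, hX, Matrix.trace_mul_comm, hY] at h1
    simp only [Matrix.trace_one, Fintype.card_fin] at h1
    exact_mod_cast h1
  have hne : ∀ {r : ℕ} {Z : Matrix (Fin n) (Fin r) ℂ}, Zᴴ * Z = 1 → r = n → Z * Zᴴ = 1 := by
    rintro r Z hZ rfl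
    exact mul_eq_one_comm.1 hZ
  have hm : m ≠ n := fun h => htop <| (Submodule.eq_top_iff').2 fun w => by
    have := hXr w
    rwa [hP, hne hX h, Matrix.one_mulVec] at this
  have hl : l ≠ n := fun h => hbot <| (Submodule.eq_bot_iff _).2 fun w hw => by
    have h0 : P = 0 := by
      have := hne hY h
      rw [hQ] at this
      simpa using this
    rw [← hXW w hw, h0, Matrix.zero_mulVec]
  have hcomm' : ∀ g, (ρ g).1 * (Y * Yᴴ) = Y * Yᴴ * (ρ g).1 := fun g => by
    rw [hQ, Matrix.mul_sub, Matrix.sub_mul, hcomm]; simp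
  rw [hP] at hcomm
  refine ⟨fun a => cond a m l, fun a => match a with
    | true => subRep ρ X hX hcomm
    | false => subRep ρ Y hY hcomm', fun a => match a with
    | true => X
    | false => Y, ?_, ?_, ?_, ?_⟩
  · rintro (_ | _)
    · change l < n; omega
    · change m < n; omega
  · rintro (_ | _)
    exacts [hY, hX]
  · rintro (_ | _)
    exacts [intertwines_subRep ρ Y hY hcomm', intertwines_subRep ρ X hX hcomm]
  · rw [Fintype.sum_bool]
    change X * Xᴴ + Y * Yᴴ = 1
    rw [hQ]; simp [hP]

theorem Intertwines.isPeriodicWith {m : ℕ} {T : Set Γ} {N : ℕ} {ρ : UnitaryRep Γ n}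
    {σ : UnitaryRep Γ m} {X : Matrix (Fin n) (Fin m) ℂ} (h : Intertwines ρ σ X)
    (hX : Xᴴ * X = 1) (hρ : IsPeriodicWith T N ρ) : IsPeriodicWith T N σ := by
  have key : ∀ g, (σ g).1 = Xᴴ * (ρ g).1 * X := fun g => by
    rw [Matrix.mul_assoc, h g, ← Matrix.mul_assoc, hX, Matrix.one_mul]
  intro g t ht
  apply Subtype.ext
  rw [key, key, hρ g t ht]

variable {κ ι : Type} [Fintype κ] [Fintype ι] [DecidableEq κ] [DecidableEq ι]
  {f : Γ → Matrix ι ι ℝ} {g : Γ → Matrix κ ι ℝ}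

/-- Positivity on a dual set implies positivity for all periodic unitary representations. -/
theorem PosSemidef_stabMatrix_of_dualSet (hf : Summable f) (hg : Summable g) {c : ℝ}
    {T : Set Γ} {EE : Set (Σ n : ℕ, UnitaryRep Γ n)} (hEE : IsPeriodicDualSet T EE)
    (hc : ∀ ρ ∈ EE, (stabMatrix f g c ρ.2).PosSemidef) {N : ℕ} (hN : N ∈ periods T) :
    ∀ (n : ℕ) (ρ : UnitaryRep Γ n), IsPeriodicWith T N ρ → (stabMatrix f g c ρ).PosSemidef := by
  intro n
  induction n using Nat.strong_induction_on with
  | _ n ih =>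
    intro ρ hρ
    rcases Nat.eq_zero_or_pos n with rfl | hn
    -- In dimension zero the representation is not irreducible by definition and cannot be
    -- decomposed further, but the matrix has no entries.
    · have : stabMatrix f g c ρ = 0 := by
        ext a; exact a.2.elim0
      rw [this]; exact Matrix.PosSemidef.zero
    by_cases hirr : IsIrred ρ
    · obtain ⟨σ, ⟨hσ, hnm, U, hU, hU', hUσ⟩, -⟩ := hEE.2 n ρ hirr ⟨N, hN, hρ⟩
      refine PosSemidef_stabMatrix_of_isometry hf hg (X := U) ?_ hU (hc σ hσ)
      intro k
      rw [← hUσ, ← Matrix.mul_assoc, ← Matrix.mul_assoc, hU', Matrix.one_mul]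
    · obtain ⟨k, τ, X, hk, hX, hint, hsum⟩ := exists_orthogonal_decomposition ρ hn hirr
      refine PosSemidef_stabMatrix_of_sum hf hg one_pos τ X hint (by simpa using hsum) fun a => ?_
      exact ih _ (hk a) _ ((hint a).isPeriodicWith (hX a) hρ)

end Reduction

section

variable {d₁ d₂ : ℕ} {G : Subgroup (EucGroup (Fin d₁ ⊕ Fin d₂))}

/-! ### The translation section and its powers. -/

section Translations

/-- The space group part of `g` is the translation by `b`. -/
def LiesOver (g : G) (b : Eu (Fin d₂)) : Prop :=
  ∃ A : OrthGroup (Fin d₁), (g : EucGroup (Fin d₁ ⊕ Fin d₂)) =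
    gplus (A, AffineIsometryEquiv.constVAdd ℝ (Eu (Fin d₂)) b)

theorem constVAdd_mul (b c : Eu (Fin d₂)) :
    AffineIsometryEquiv.constVAdd ℝ (Eu (Fin d₂)) b * AffineIsometryEquiv.constVAdd ℝ _ c =
      AffineIsometryEquiv.constVAdd ℝ _ (b + c) :=
  AffineIsometryEquiv.ext fun x => (add_assoc b c x).symm

theorem LiesOver.mul {g h : G} {b c : Eu (Fin d₂)} (hg : LiesOver g b) (hh : LiesOver h c) :
    LiesOver (g * h) (b + c) := by
  obtain ⟨A, hA⟩ := hg
  obtain ⟨B, hB⟩ := hh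
  refine ⟨A * B, ?_⟩
  rw [Subgroup.coe_mul, hA, hB, ← map_mul, Prod.mk_mul_mk, constVAdd_mul]

theorem LiesOver.one : LiesOver (1 : G) 0 := by
  refine ⟨1, ?_⟩
  have h : AffineIsometryEquiv.constVAdd ℝ (Eu (Fin d₂)) 0 = 1 :=
    AffineIsometryEquiv.ext fun x => zero_add x
  rw [h]
  exact (map_one gplus).symm

theorem LiesOver.pow {g : G} {b : Eu (Fin d₂)} (hg : LiesOver g b) (N : ℕ) :
    LiesOver (g ^ N) (N • b) := by
  induction N with
  | zero => simpa using LiesOver.one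
  | succ k ih => simpa only [pow_succ, succ_nsmul] using ih.mul hg

theorem LiesOver.sndPart_apply {g : G} {b : Eu (Fin d₂)} (hg : LiesOver g b)
    (x : Eu (Fin d₁ ⊕ Fin d₂)) : sndPart (g.1 x) = b + sndPart x := by
  obtain ⟨A, hA⟩ := hg
  rw [hA]
  change sndPart (blockIso A _ x) = _
  rw [blockIso_apply, sndPart_joinPart]
  rfl

theorem LiesOver.unique {g : G} {b c : Eu (Fin d₂)} (hb : LiesOver g b) (hc : LiesOver g c) :
    b = c := by
  have h := (hb.sndPart_apply 0).symm.trans (hc.sndPart_apply 0)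
  simpa using h

variable {T : Set G}

theorem IsTranslationSection.liesOver (hT : IsTranslationSection G T) {t : G} (ht : t ∈ T) :
    ∃ b, LiesOver t b := by
  obtain ⟨A, b, h⟩ := hT.1 t ht
  exact ⟨b, A, h⟩

theorem IsTranslationSection.eq_of_liesOver (hT : IsTranslationSection G T) {s t : G}
    (hs : s ∈ T) (ht : t ∈ T) {b : Eu (Fin d₂)} (hsb : LiesOver s b) (htb : LiesOver t b) :
    s = t := by
  have hb : AffineIsometryEquiv.constVAdd ℝ (Eu (Fin d₂)) b ∈ spacePart G := by
    obtain ⟨A, hA⟩ := hsb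
    exact ⟨(A, _), Subgroup.mem_comap.2 (hA ▸ s.2), rfl⟩
  exact (hT.2 b hb).unique ⟨hs, hsb⟩ ⟨ht, htb⟩

theorem nsmul_left_cancel {N : ℕ} (hN : 0 < N) {b c : Eu (Fin d₂)} (h : N • b = N • c) : b = c := by
  rw [← Nat.cast_smul_eq_nsmul ℝ, ← Nat.cast_smul_eq_nsmul ℝ] at h
  exact smul_right_injective _ (Nat.cast_ne_zero.2 hN.ne') h

/-- Both `xy` and `yx` are `N`-th powers of elements of the section and lie over the same
translation. Division by `N` shows that these two elements of the section lie over the same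
translation, hence coincide. -/
theorem IsTranslationSection.commute (hT : IsTranslationSection G T) {N : ℕ} (hN : 0 < N)
    {H : Subgroup G} (hH : (H : Set G) = powSet T N) {x y : G} (hx : x ∈ H) (hy : y ∈ H) :
    Commute x y := by
  have hmem : ∀ z, z ∈ H ↔ z ∈ powSet T N := fun z => by rw [← hH]; rfl
  obtain ⟨s, hs, hsx⟩ := (hmem x).1 hx
  obtain ⟨t, ht, hty⟩ := (hmem y).1 hy
  obtain ⟨p, hp, hpxy⟩ := (hmem _).1 (H.mul_mem hx hy)
  obtain ⟨q, hq, hqyx⟩ := (hmem _).1 (H.mul_mem hy hx)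
  dsimp only at hsx hty hpxy hqyx
  obtain ⟨bs, hbs⟩ := hT.liesOver hs
  obtain ⟨bt, hbt⟩ := hT.liesOver ht
  obtain ⟨bp, hbp⟩ := hT.liesOver hp
  obtain ⟨bq, hbq⟩ := hT.liesOver hq
  have hX : LiesOver x (N • bs) := hsx ▸ hbs.pow N
  have hY : LiesOver y (N • bt) := hty ▸ hbt.pow N
  have h1 : N • bp = N • (bs + bt) := by
    rw [nsmul_add]; exact (hpxy ▸ hbp.pow N).unique (hX.mul hY)
  have h2 : N • bq = N • (bs + bt) := by
    rw [nsmul_add, add_comm]; exact (hqyx ▸ hbq.pow N).unique (hY.mul hX)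
  have h3 : bp = bq := nsmul_left_cancel hN (h1.trans h2.symm)
  have h4 : p = q := hT.eq_of_liesOver hp hq hbp (h3 ▸ hbq)
  exact (hpxy.symm.trans (h4 ▸ hqyx) : x * y = y * x)

/-- The `M`-th powers of a commutative normal subgroup again form a normal subgroup. This provides
common periods. -/
theorem IsTranslationSection.mul_mem_periods (hT : IsTranslationSection G T) {N M : ℕ}
    (hN : N ∈ periods T) (hM : 0 < M) : N * M ∈ periods T := by
  obtain ⟨hN0, H, hHn, hH⟩ := hN
  have hmem : ∀ z, z ∈ H ↔ z ∈ powSet T N := fun z => by rw [← hH]; rfl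
  have hpow : powSet T (N * M) = (fun x => x ^ M) '' (H : Set G) := by
    rw [hH, powSet, powSet, Set.image_image]
    simp only [pow_mul]
  refine ⟨Nat.mul_pos hN0 hM,
    { carrier := powSet T (N * M)
      mul_mem' := ?_
      one_mem' := ?_
      inv_mem' := ?_ }, ⟨?_⟩, rfl⟩
  · rw [hpow]
    rintro _ _ ⟨x, hx, rfl⟩ ⟨y, hy, rfl⟩
    exact ⟨x * y, H.mul_mem hx hy, (hT.commute hN0 hH hx hy).mul_pow M⟩
  · rw [hpow]
    exact ⟨1, H.one_mem, one_pow M⟩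
  · intro z hz
    change z ∈ powSet T (N * M) at hz
    change z⁻¹ ∈ powSet T (N * M)
    rw [hpow] at hz ⊢
    obtain ⟨x, hx, rfl⟩ := hz
    exact ⟨x⁻¹, H.inv_mem hx, inv_pow x M⟩
  · intro z hz g
    change z ∈ powSet T (N * M) at hz
    change g * z * g⁻¹ ∈ powSet T (N * M)
    rw [hpow] at hz ⊢
    obtain ⟨x, hx, rfl⟩ := hz
    exact ⟨g * x * g⁻¹, hHn.conj_mem x hx g, conj_pow⟩

end Translations

/-! ### Period subgroups and periodic functions. -/

section PowSubgroup

variable {Γ : Type} [Group Γ] {T : Set Γ} {N M : ℕ}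

theorem coe_powSubgroup (hN : N ∈ periods T) : (powSubgroup T N : Set Γ) = powSet T N := by
  obtain ⟨-, H, -, hH⟩ := hN
  rw [powSubgroup, ← hH, Subgroup.closure_eq]

theorem normal_powSubgroup (hN : N ∈ periods T) : (powSubgroup T N).Normal := by
  obtain ⟨-, H, hn, hH⟩ := hN
  rwa [powSubgroup, ← hH, Subgroup.closure_eq]

theorem mem_powSubgroup (hN : N ∈ periods T) {x : Γ} : x ∈ powSubgroup T N ↔ x ∈ powSet T N := by
  rw [← coe_powSubgroup hN]; rfl

theorem powSet_mul_subset (hN : N ∈ periods T) (M : ℕ) : powSet T (N * M) ⊆ powSet T N := by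
  rintro _ ⟨t, ht, rfl⟩
  dsimp only
  rw [pow_mul]
  exact (mem_powSubgroup hN).1 ((powSubgroup T N).pow_mem ((mem_powSubgroup hN).2 ⟨t, ht, rfl⟩) M)

theorem powSubgroup_mul_le (hN : N ∈ periods T) (M : ℕ) :
    powSubgroup T (N * M) ≤ powSubgroup T N :=
  Subgroup.closure_mono (powSet_mul_subset hN M)

theorem IsPeriodicWith.mul {X : Type*} {u : Γ → X} (hu : IsPeriodicWith T N u)
    (hN : N ∈ periods T) (M : ℕ) : IsPeriodicWith T (N * M) u :=
  fun g t ht => hu g t (powSet_mul_subset hN M ht)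

/-- Normality moves the period to the right end: `g t h = (g h)(h⁻¹ t h)`. -/
theorem IsPeriodicWith.apply_mul_mul {X : Type*} {u : Γ → X} (hu : IsPeriodicWith T N u)
    (hN : N ∈ periods T) (g h : Γ) {t : Γ} (ht : t ∈ powSet T N) : u (g * t * h) = u (g * h) := by
  have h1 : h⁻¹ * t * h ∈ powSet T N := by
    rw [← mem_powSubgroup hN] at ht ⊢
    simpa using (normal_powSubgroup hN).conj_mem t ht h⁻¹
  rw [← hu (g * h) _ h1]
  congr 1
  group

theorem IsPeriodicWith.eq_of_mk_eq {X : Type*} {u : Γ → X} (hu : IsPeriodicWith T N u)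
    (hN : N ∈ periods T) {g h : Γ} (hgh : (g : Γ ⧸ powSubgroup T N) = h) : u g = u h := by
  rw [QuotientGroup.eq, mem_powSubgroup hN] at hgh
  rw [← hu g _ hgh, mul_inv_cancel_left]

theorem IsPeriodicWith.out_mk {X : Type*} {u : Γ → X} (hu : IsPeriodicWith T N u)
    (hN : N ∈ periods T) (g : Γ) : u (g : Γ ⧸ powSubgroup T N).out = u g :=
  hu.eq_of_mk_eq hN (QuotientGroup.out_eq' _)

end PowSubgroup

/-! ### Finite index of the period subgroups. -/

section FiniteIndex

variable {x₀ : Eu (Fin d₁ ⊕ Fin d₂)}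

/-- The isolation radius at `x₀` is transported by isometries to every orbit point, so the orbit is
uniformly separated; a bounded set is covered by finitely many balls of half that radius, each
containing at most one orbit point. -/
theorem finite_setOf_norm_apply_le (hG : IsDiscreteGroup G)
    (hx₀ : Function.Injective fun g : G => g.1 x₀) (C : ℝ) : {g : G | ‖g.1 x₀‖ ≤ C}.Finite := by
  have hS := hG x₀
  set S := (fun g : EucGroup (Fin d₁ ⊕ Fin d₂) => g x₀) '' (G : Set _)
  have hx : x₀ ∈ S := ⟨1, G.one_mem, rfl⟩
  obtain ⟨r, hr, hball⟩ := Metric.exists_ball_inter_eq_singleton_of_mem_discrete ⟨hS⟩ hx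
  have hsep : ∀ g k : G, dist (g.1 x₀) (k.1 x₀) < r → g = k := by
    intro g k h
    have h1 : (k⁻¹ * g).1 x₀ ∈ Metric.ball x₀ r ∩ S := by
      refine ⟨?_, (k⁻¹ * g).1, (k⁻¹ * g).2, rfl⟩
      have h1 : k.1 ((k⁻¹ * g).1 x₀) = g.1 x₀ := k.1.apply_symm_apply _
      rwa [Metric.mem_ball, ← k.1.dist_map, h1]
    rw [hball, Set.mem_singleton_iff] at h1
    have h2 : k⁻¹ * g = 1 := hx₀ (by simpa using h1)
    exact (inv_mul_eq_one.1 h2).symm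
  obtain ⟨t, htf, ht⟩ := Metric.totallyBounded_iff.1
    (isCompact_closedBall (0 : Eu (Fin d₁ ⊕ Fin d₂)) C).totallyBounded (r / 2) (half_pos hr)
  refine (htf.biUnion (t := fun y => {g : G | g.1 x₀ ∈ Metric.ball y (r / 2)}) fun y _ =>
    Set.Subsingleton.finite fun g hg k hk => hsep g k ?_).subset fun g hg => ?_
  · have := dist_triangle_right (g.1 x₀) (k.1 x₀) y
    rw [Set.mem_ofPred_eq, Metric.mem_ball] at hg hk
    linarith
  · have h := ht (show g.1 x₀ ∈ Metric.closedBall 0 C by simpa using hg)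
    simpa using h

/-- The last `d₂` coordinates can be moved into a fundamental cell of `N` times the lattice spanned
by `b`, and the first `d₁` coordinates keep their norm since the group acts on them orthogonally. -/
theorem exists_powSet_mul_norm_le (hG : IsStandardDiscrete G) {T : Set G}
    (hT : IsTranslationSection G T) (x₀ : Eu (Fin d₁ ⊕ Fin d₂)) {N : ℕ} (hN : 0 < N) :
    ∃ C : ℝ, ∀ g : G, ∃ t ∈ powSet T N, ‖(t * g).1 x₀‖ ≤ C := by
  obtain ⟨-, b, hb, hbS⟩ := hG.space
  let B : Module.Basis (Fin d₂) ℝ (Eu (Fin d₂)) :=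
    Module.Basis.mk hb (hb.span_eq_top_of_card_eq_finrank' (by simp)).ge
  let L : AddSubgroup (Eu (Fin d₂)) :=
    { carrier := {c | AffineIsometryEquiv.constVAdd ℝ (Eu (Fin d₂)) c ∈ spacePart G}
      add_mem' := fun {c e} hc he => by
        rw [Set.mem_ofPred_eq, ← constVAdd_mul]; exact (spacePart G).mul_mem hc he
      zero_mem' := by
        have h : AffineIsometryEquiv.constVAdd ℝ (Eu (Fin d₂)) 0 = 1 :=
          AffineIsometryEquiv.ext fun x => zero_add x
        rw [Set.mem_ofPred_eq, h]; exact (spacePart G).one_mem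
      neg_mem' := fun {c} hc => by
        have h : AffineIsometryEquiv.constVAdd ℝ (Eu (Fin d₂)) (-c) =
            (AffineIsometryEquiv.constVAdd ℝ (Eu (Fin d₂)) c)⁻¹ :=
          AffineIsometryEquiv.ext fun x => rfl
        rw [Set.mem_ofPred_eq, h]; exact (spacePart G).inv_mem hc }
  have hL : ∀ c ∈ Submodule.span ℤ (Set.range B), c ∈ L := by
    intro c hc
    have : Submodule.span ℤ (Set.range B) ≤ AddSubgroup.toIntSubmodule L := by
      rw [Submodule.span_le]
      rintro _ ⟨i, rfl⟩
      simp only [B, Module.Basis.mk_apply]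
      exact hbS i
    exact this hc
  refine ⟨√(‖fstPart x₀‖ ^ 2 + (N * ∑ i, ‖B i‖) ^ 2), fun g => ?_⟩
  obtain ⟨⟨A, h⟩, hg⟩ := hG.block g.2
  set y := sndPart (g.1 x₀) with hy
  -- Rounding `y / N` instead of `y` makes the lattice vector divisible by `N`: `y + N c` is `N`
  -- times the fractional part of `y / N`.
  set c : Eu (Fin d₂) := -(ZSpan.floor B ((N : ℝ)⁻¹ • y) : Eu (Fin d₂)) with hc
  have hcL : c ∈ L := L.neg_mem (hL _ (ZSpan.floor B _).2)
  obtain ⟨t, ⟨htT, At, hAt⟩, -⟩ := hT.2 c hcL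
  have htc : LiesOver (t ^ N) (N • c) := LiesOver.pow ⟨At, hAt⟩ N
  refine ⟨t ^ N, ⟨t, htT, rfl⟩, ?_⟩
  have hsnd : sndPart ((t ^ N * g).1 x₀) = (N : ℝ) • ZSpan.fract B ((N : ℝ)⁻¹ • y) := by
    change sndPart ((t ^ N).1 (g.1 x₀)) = _
    rw [htc.sndPart_apply, ZSpan.fract_apply, smul_sub, smul_inv_smul₀ (Nat.cast_ne_zero.2 hN.ne'),
      hc, ← Nat.cast_smul_eq_nsmul ℝ, smul_neg, ← hy]
    abel
  have hfst : ‖fstPart ((t ^ N * g).1 x₀)‖ = ‖fstPart x₀‖ := by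
    obtain ⟨A', hA'⟩ := htc
    change ‖fstPart ((t ^ N).1 (g.1 x₀))‖ = _
    rw [hA', ← hg]
    change ‖fstPart (blockIso A' _ (blockIso A h x₀))‖ = _
    rw [blockIso_apply, blockIso_apply]
    simp
  rw [← joinPart_parts ((t ^ N * g).1 x₀)]
  apply Real.le_sqrt_of_sq_le
  rw [norm_sq_joinPart, hfst, hsnd, norm_smul, Real.norm_natCast]
  gcongr
  exact ZSpan.norm_fract_le B _

theorem finite_quotient_powSubgroup (hG : IsStandardDiscrete G) {T : Set G}
    (hT : IsTranslationSection G T) (hx₀ : Function.Injective fun g : G => g.1 x₀) {N : ℕ}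
    (hN : N ∈ periods T) : Finite (G ⧸ powSubgroup T N) := by
  obtain ⟨C, hC⟩ := exists_powSet_mul_norm_le hG hT x₀ hN.1
  have := normal_powSubgroup hN
  refine Set.finite_univ_iff.1
    (((finite_setOf_norm_apply_le hG.discrete hx₀ C).image QuotientGroup.mk).subset fun q _ => ?_)
  obtain ⟨g, rfl⟩ := QuotientGroup.mk_surjective q
  obtain ⟨t, ht, htg⟩ := hC g
  refine ⟨t * g, htg, ?_⟩
  rw [QuotientGroup.mk_mul, (QuotientGroup.eq_one_iff t).2 ((mem_powSubgroup hN).2 ht), one_mul]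

end FiniteIndex

end

/-! ### Means of periodic functions. -/

section Mean

variable {Γ : Type} [Group Γ] {T : Set Γ} {N M : ℕ}

/-- Multiples of periods are periods, and the quotients by the period subgroups are finite. -/
structure HasFinitePeriods (T : Set Γ) : Prop where
  mul_mem : ∀ N ∈ periods T, ∀ M, 0 < M → N * M ∈ periods T
  finite : ∀ N ∈ periods T, Finite (Γ ⧸ powSubgroup T N)

theorem IsTranslationSection.hasFinitePeriods {d₁ d₂ : ℕ}
    {G : Subgroup (EucGroup (Fin d₁ ⊕ Fin d₂))} (hG : IsStandardDiscrete G) {T : Set G}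
    (hT : IsTranslationSection G T) {x₀ : Eu (Fin d₁ ⊕ Fin d₂)}
    (hx₀ : Function.Injective fun g : G => g.1 x₀) : HasFinitePeriods T :=
  ⟨fun _ hN _ hM => hT.mul_mem_periods hN hM, fun _ hN => finite_quotient_powSubgroup hG hT hx₀ hN⟩

theorem IsPeriodic.comp {X Y : Type*} {u : Γ → X} (hu : IsPeriodic T u) (φ : X → Y) :
    IsPeriodic T fun g => φ (u g) := by
  obtain ⟨N, hN, h⟩ := hu
  exact ⟨N, hN, fun g t ht => congrArg φ (h g t ht)⟩

theorem IsPeriodic.prodMk {X Y : Type*} (hT : HasFinitePeriods T) {u : Γ → X} {w : Γ → Y}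
    (hu : IsPeriodic T u) (hw : IsPeriodic T w) : IsPeriodic T fun g => (u g, w g) := by
  obtain ⟨N, hN, h⟩ := hu
  obtain ⟨M, hM, k⟩ := hw
  refine ⟨N * M, hT.mul_mem N hN M hM.1, fun g t ht => Prod.ext (h.mul hN M g t ht) ?_⟩
  rw [mul_comm] at ht
  exact k.mul hM N g t ht

theorem IsPeriodic.comp₂ {X Y Z : Type*} (hT : HasFinitePeriods T) {u : Γ → X} {w : Γ → Y}
    (hu : IsPeriodic T u) (hw : IsPeriodic T w) (φ : X → Y → Z) :
    IsPeriodic T fun g => φ (u g) (w g) :=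
  (hu.prodMk hT hw).comp fun p => φ p.1 p.2

theorem IsPeriodic.finite_range {X : Type*} (hT : HasFinitePeriods T) {u : Γ → X}
    (hu : IsPeriodic T u) : (Set.range u).Finite := by
  obtain ⟨N, hN, h⟩ := hu
  have := hT.finite N hN
  refine (Set.finite_range fun q : Γ ⧸ powSubgroup T N => u q.out).subset ?_
  rintro _ ⟨g, rfl⟩
  exact ⟨g, h.out_mk hN g⟩

theorem IsPeriodic.period_spec {X : Type*} {u : Γ → X} (hu : IsPeriodic T u) :
    period T u ∈ periods T ∧ IsPeriodicWith T (period T u) u := by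
  rw [period, dif_pos hu]
  exact hu.choose_spec

theorem cosetMean_eq_sum [Fintype (Γ ⧸ powSubgroup T N)] (F : Γ → ℝ) :
    cosetMean T N F = (Nat.card (Γ ⧸ powSubgroup T N) : ℝ)⁻¹ *
      ∑ q : Γ ⧸ powSubgroup T N, F q.out := by
  rw [cosetMean, finsum_eq_sum_of_fintype]

/-- Passing to the finer quotient repeats each value of `F` equally often, namely as often as the
index of the smaller subgroup in the larger one. -/
theorem cosetMean_mul (hT : HasFinitePeriods T) {F : Γ → ℝ} (hN : N ∈ periods T) (hM : 0 < M)
    (hF : IsPeriodicWith T N F) : cosetMean T (N * M) F = cosetMean T N F := by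
  classical
  have hNM := hT.mul_mem N hN M hM
  have h1 := hT.finite N hN
  have h2 := hT.finite _ hNM
  have hle := powSubgroup_mul_le hN M
  let e := Subgroup.quotientEquivProdOfLE hle
  have h3 : Finite ((Γ ⧸ powSubgroup T N) ×
    powSubgroup T N ⧸ (powSubgroup T (N * M)).subgroupOf (powSubgroup T N)) := Finite.of_equiv _ e
  have h4 : Finite (powSubgroup T N ⧸ (powSubgroup T (N * M)).subgroupOf (powSubgroup T N)) :=
    Finite.prod_right (Γ ⧸ powSubgroup T N)
  have := Fintype.ofFinite (Γ ⧸ powSubgroup T N)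
  have := Fintype.ofFinite (Γ ⧸ powSubgroup T (N * M))
  have := Fintype.ofFinite
    (powSubgroup T N ⧸ (powSubgroup T (N * M)).subgroupOf (powSubgroup T N))
  have hsum : ∑ q : Γ ⧸ powSubgroup T (N * M), F q.out =
      ∑ q : Γ ⧸ powSubgroup T (N * M), (fun p => F p.1.out) (e q) := by
    refine Finset.sum_congr rfl fun q _ => ?_
    obtain ⟨g, rfl⟩ := QuotientGroup.mk_surjective q
    rw [(hF.mul hN M).out_mk hNM]
    exact (hF.out_mk hN g).symm
  rw [cosetMean_eq_sum, cosetMean_eq_sum, hsum, e.sum_comp fun p => F p.1.out, Fintype.sum_prod_type,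
    Nat.card_congr e, Nat.card_prod]
  simp only [Finset.sum_const, Finset.card_univ, nsmul_eq_mul, ← Finset.mul_sum, Nat.cast_mul,
    ← Nat.card_eq_fintype_card]
  have h5 : (Nat.card (powSubgroup T N ⧸
      (powSubgroup T (N * M)).subgroupOf (powSubgroup T N)) : ℝ) ≠ 0 :=
    Nat.cast_ne_zero.2 Nat.card_pos.ne'
  rw [mul_inv, mul_assoc, inv_mul_cancel_left₀ h5]

/-- The mean of a periodic function. -/
def mean (T : Set Γ) (F : Γ → ℝ) : ℝ := cosetMean T (period T F) F

/-- Any period and the chosen one are compared through their product. This removes the arbitrary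
choice made in `period`. -/
theorem mean_eq_cosetMean (hT : HasFinitePeriods T) {F : Γ → ℝ} (hN : N ∈ periods T)
    (hF : IsPeriodicWith T N F) : mean T F = cosetMean T N F := by
  obtain ⟨h1, h2⟩ := IsPeriodic.period_spec ⟨N, hN, hF⟩
  rw [mean, ← cosetMean_mul hT h1 hN.1 h2, mul_comm, cosetMean_mul hT hN h1.1 hF]

theorem mean_add (hT : HasFinitePeriods T) {F F' : Γ → ℝ} (hF : IsPeriodic T F)
    (hF' : IsPeriodic T F') : mean T (fun g => F g + F' g) = mean T F + mean T F' := by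
  obtain ⟨N, hN, h⟩ := hF.prodMk hT hF'
  have := hT.finite N hN
  have := Fintype.ofFinite (Γ ⧸ powSubgroup T N)
  rw [mean_eq_cosetMean hT hN fun g t ht => congrArg (fun p => p.1 + p.2) (h g t ht),
    mean_eq_cosetMean hT hN fun g t ht => congrArg Prod.fst (h g t ht),
    mean_eq_cosetMean hT hN fun g t ht => congrArg Prod.snd (h g t ht)]
  simp only [cosetMean_eq_sum, Finset.sum_add_distrib, mul_add]

theorem mean_mul_left (hT : HasFinitePeriods T) {F : Γ → ℝ} (hF : IsPeriodic T F) (c : ℝ) :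
    mean T (fun g => c * F g) = c * mean T F := by
  obtain ⟨N, hN, h⟩ := hF
  have := hT.finite N hN
  have := Fintype.ofFinite (Γ ⧸ powSubgroup T N)
  rw [mean_eq_cosetMean hT hN fun g t ht => congrArg (c * ·) (h g t ht),
    mean_eq_cosetMean hT hN h]
  simp only [cosetMean_eq_sum, ← Finset.mul_sum]
  ring

theorem mean_sub (hT : HasFinitePeriods T) {F F' : Γ → ℝ} (hF : IsPeriodic T F)
    (hF' : IsPeriodic T F') : mean T (fun g => F g - F' g) = mean T F - mean T F' := by
  have h := mean_add hT hF (hF'.comp fun x => -1 * x)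
  rw [mean_mul_left hT hF'] at h
  calc _ = mean T (fun g => F g + -1 * F' g) := by congr 1; ext g; ring
    _ = _ := by rw [h]; ring

theorem abs_mean_le (hT : HasFinitePeriods T) {F : Γ → ℝ} (hF : IsPeriodic T F) {C : ℝ}
    (hC : ∀ g, |F g| ≤ C) : |mean T F| ≤ C := by
  obtain ⟨N, hN, h⟩ := hF
  have := hT.finite N hN
  have := Fintype.ofFinite (Γ ⧸ powSubgroup T N)
  rw [mean_eq_cosetMean hT hN h, cosetMean_eq_sum, abs_mul, abs_of_nonneg (by positivity)]
  have h1 : |∑ q : Γ ⧸ powSubgroup T N, F q.out| ≤ Nat.card (Γ ⧸ powSubgroup T N) * C := by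
    refine (Finset.abs_sum_le_sum_abs _ _).trans ?_
    refine (Finset.sum_le_sum fun q _ => hC q.out).trans ?_
    simp [Nat.card_eq_fintype_card]
  have h2 : (0 : ℝ) < Nat.card (Γ ⧸ powSubgroup T N) := Nat.cast_pos.2 Nat.card_pos
  rwa [inv_mul_le_iff₀ h2]

end Mean

/-! ### Differentiation under the mean. -/

section Calculus

variable {Γ : Type} [Group Γ] {T : Set Γ} {X E : Type*} [NormedAddCommGroup X] [NormedSpace ℝ X]
  [NormedAddCommGroup E] [NormedSpace ℝ E]

theorem exists_mean_clm (hT : HasFinitePeriods T) {Φ : Γ → X →L[ℝ] ℝ} {C : ℝ}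
    (hC : ∀ g, ‖Φ g‖ ≤ C) (hΦ : ∀ w, IsPeriodic T fun g => Φ g w) :
    ∃ L : X →L[ℝ] ℝ, ∀ w, L w = mean T fun g => Φ g w := by
  refine ⟨LinearMap.mkContinuous
    { toFun := fun w => mean T fun g => Φ g w
      map_add' := fun w w' => by
        simp only [map_add]; exact mean_add hT (hΦ w) (hΦ w')
      map_smul' := fun c w => by
        simp only [map_smul, smul_eq_mul, RingHom.id_apply]
        exact mean_mul_left hT (hΦ w) c } C fun w => ?_, fun w => rfl⟩
  exact abs_mean_le hT (hΦ w) fun g => (Φ g).le_of_opNorm_le (hC g) w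

variable {v : E → ℝ} {Λ : Γ → X →L[ℝ] E}

/-- For fixed `u` the points `Λ g u` take only finitely many values, so the remainder estimates of
`v` at these points hold with a common radius. The period of the increment may vary; only the bound
on `Λ g` enters. -/
theorem exists_hasFDerivAt_mean (hT : HasFinitePeriods T) (hv : Differentiable ℝ v) {K : ℝ}
    (hK : 0 < K) (hΛ : ∀ g, ‖Λ g‖ ≤ K) (hper : ∀ u, IsPeriodic T fun g => Λ g u) (u : X) :
    ∃ L : X →L[ℝ] ℝ, (∀ w, L w = mean T fun g => fderiv ℝ v (Λ g u) (Λ g w)) ∧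
      HasFDerivAt (fun u => mean T fun g => v (Λ g u)) L u := by
  have hfin := (hper u).finite_range hT
  obtain ⟨C, hC⟩ := (hfin.image fun x => ‖fderiv ℝ v x‖).bddAbove
  have hC' : ∀ g, ‖fderiv ℝ v (Λ g u)‖ ≤ C := fun g => hC ⟨_, ⟨g, rfl⟩, rfl⟩
  obtain ⟨L, hL⟩ := exists_mean_clm hT (Φ := fun g => (fderiv ℝ v (Λ g u)).comp (Λ g))
    (C := C * K) (fun g => (ContinuousLinearMap.opNorm_comp_le _ _).trans
      (mul_le_mul (hC' g) (hΛ g) (norm_nonneg _) ((norm_nonneg _).trans (hC' g))))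
    (fun w => (hper u).comp₂ hT (hper w) fun x y => fderiv ℝ v x y)
  refine ⟨L, hL, ?_⟩
  rw [hasFDerivAt_iff_isLittleO_nhds_zero, Asymptotics.isLittleO_iff]
  intro ε hε
  have hev : ∀ᶠ y in nhds (0 : E), ∀ x ∈ Set.range (fun g => Λ g u),
      ‖v (x + y) - v x - fderiv ℝ v x y‖ ≤ ε / K * ‖y‖ :=
    (Set.Finite.eventually_all hfin).2 fun x _ =>
      (Asymptotics.isLittleO_iff.1 (hasFDerivAt_iff_isLittleO_nhds_zero.1 (hv x).hasFDerivAt))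
        (div_pos hε hK)
  obtain ⟨δ, hδ, hball⟩ := Metric.eventually_nhds_iff.1 hev
  refine Metric.eventually_nhds_iff.2 ⟨δ / K, div_pos hδ hK, fun w hw => ?_⟩
  have hΛw : ∀ g, ‖Λ g w‖ ≤ K * ‖w‖ := fun g => (Λ g).le_of_opNorm_le (hΛ g) w
  rw [dist_zero_right, lt_div_iff₀ hK, mul_comm] at hw
  have p1 := (hper (u + w)).comp v
  have p2 := (hper u).comp v
  have p3 := (hper u).comp₂ hT (hper w) fun x y => fderiv ℝ v x y
  have hLw : L w = mean T fun g => fderiv ℝ v (Λ g u) (Λ g w) := hL w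
  rw [hLw, ← mean_sub hT p1 p2, ← mean_sub hT (p1.comp₂ hT p2 fun x y => x - y) p3,
    Real.norm_eq_abs]
  refine abs_mean_le hT ((p1.comp₂ hT p2 _).comp₂ hT p3 _) fun g => ?_
  have h := hball (y := Λ g w) (by rw [dist_zero_right]; exact (hΛw g).trans_lt hw) _ ⟨g, rfl⟩
  rw [← map_add, Real.norm_eq_abs] at h
  refine h.trans ?_
  calc ε / K * ‖Λ g w‖ ≤ ε / K * (K * ‖w‖) := by gcongr; exact hΛw g
    _ = ε * ‖w‖ := by field_simp

/-- Twofold differentiation at zero under the mean. -/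
theorem fderiv_fderiv_mean (hT : HasFinitePeriods T) (hv : ContDiff ℝ 2 v) {K : ℝ}
    (hK : 0 < K) (hΛ : ∀ g, ‖Λ g‖ ≤ K) (hper : ∀ u, IsPeriodic T fun g => Λ g u) (u w : X) :
    fderiv ℝ (fderiv ℝ fun u => mean T fun g => v (Λ g u)) 0 u w =
      mean T fun g => fderiv ℝ (fderiv ℝ v) 0 (Λ g u) (Λ g w) := by
  have hv1 : Differentiable ℝ v := hv.differentiable (by norm_num)
  have hv2 : DifferentiableAt ℝ (fderiv ℝ v) 0 :=
    (hv.fderiv_right (m := 1) (by norm_num)).differentiable (by norm_num) 0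
  set D2 := fderiv ℝ (fderiv ℝ v) 0 with hD2
  choose D hD hDderiv using exists_hasFDerivAt_mean hT hv1 hK hΛ hper
  have hfd : fderiv ℝ (fun u => mean T fun g => v (Λ g u)) = D :=
    funext fun u => (hDderiv u).fderiv
  have p2 : ∀ u w, IsPeriodic T fun g => D2 (Λ g u) (Λ g w) := fun u w =>
    (hper u).comp₂ hT (hper w) fun x y => D2 x y
  have hΛw : ∀ g w, ‖Λ g w‖ ≤ K * ‖w‖ := fun g w => (Λ g).le_of_opNorm_le (hΛ g) w
  have hB : ∀ u, ∃ L : X →L[ℝ] ℝ, ∀ w, L w = mean T fun g => D2 (Λ g u) (Λ g w) := fun u =>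
    exists_mean_clm hT (Φ := fun g => (D2 (Λ g u)).comp (Λ g))
      (C := ‖D2‖ * (K * ‖u‖) * K) (fun g => (ContinuousLinearMap.opNorm_comp_le _ _).trans
        (mul_le_mul (D2.le_opNorm_of_le (hΛw g u)) (hΛ g) (norm_nonneg _) (by positivity)))
      (p2 u)
  choose B hB using hB
  let B' : X →L[ℝ] X →L[ℝ] ℝ := LinearMap.mkContinuous₂
    (LinearMap.mk₂ ℝ (fun u w => B u w)
      (fun u u' w => by
        simp only [hB, map_add, add_apply]
        exact mean_add hT (p2 u w) (p2 u' w))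
      (fun c u w => by
        simp only [hB, map_smul, smul_apply, smul_eq_mul]
        exact mean_mul_left hT (p2 u w) c)
      (fun u w w' => map_add _ _ _) (fun c u w => map_smul _ _ _)) (‖D2‖ * K * K) fun u w => by
        change ‖B u w‖ ≤ _
        rw [hB]
        refine abs_mean_le hT (p2 u w) fun g => ?_
        refine (D2.le_opNorm₂ _ _).trans ?_
        calc ‖D2‖ * ‖Λ g u‖ * ‖Λ g w‖ ≤ ‖D2‖ * (K * ‖u‖) * (K * ‖w‖) := by
              gcongr <;> exact hΛw g _
          _ = _ := by ring
  -- At zero all base points `Λ g 0` coincide, so a single remainder estimate for `fderiv ℝ v` at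
  -- `0` serves all `g`; the factor `K * K` comes from the two arguments.
  have hder : HasFDerivAt D B' 0 := by
    rw [hasFDerivAt_iff_isLittleO_nhds_zero, Asymptotics.isLittleO_iff]
    intro ε hε
    have hev := (Asymptotics.isLittleO_iff.1
      (hasFDerivAt_iff_isLittleO_nhds_zero.1 hv2.hasFDerivAt)) (div_pos hε (mul_pos hK hK))
    obtain ⟨δ, hδ, hball⟩ := Metric.eventually_nhds_iff.1 hev
    refine Metric.eventually_nhds_iff.2 ⟨δ / K, div_pos hδ hK, fun u hu => ?_⟩
    rw [dist_zero_right, lt_div_iff₀ hK, mul_comm] at hu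
    refine ContinuousLinearMap.opNorm_le_bound _ (by positivity) fun w => ?_
    have q : ∀ u, IsPeriodic T fun g => fderiv ℝ v (Λ g u) (Λ g w) := fun u =>
      (hper u).comp₂ hT (hper w) fun x y => fderiv ℝ v x y
    have hBu : B' u w = mean T fun g => D2 (Λ g u) (Λ g w) := hB u w
    rw [sub_apply, sub_apply, hD, hD, hBu,
      ← mean_sub hT (q _) (q _), ← mean_sub hT ((q _).comp₂ hT (q _) fun x y => x - y) (p2 u w),
      Real.norm_eq_abs]
    refine abs_mean_le hT (((q _).comp₂ hT (q _) _).comp₂ hT (p2 u w) _) fun g => ?_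
    have h := hball (y := Λ g u) (by rw [dist_zero_right]; exact (hΛw g u).trans_lt hu)
    have h' := ContinuousLinearMap.le_of_opNorm_le _ h (Λ g w)
    simp only [sub_apply, Real.norm_eq_abs] at h'
    simp only [map_zero, zero_add] at h' ⊢
    refine h'.trans ?_
    calc ε / (K * K) * ‖Λ g u‖ * ‖Λ g w‖ ≤ ε / (K * K) * (K * ‖u‖) * (K * ‖w‖) := by
          gcongr <;> exact hΛw g _
      _ = ε * ‖u‖ * ‖w‖ := by field_simp
  rw [hfd, hder.fderiv]
  exact hB u w

end Calculus

/-! ### The energy and its second derivative. -/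

section

variable {d₁ d₂ : ℕ} {G : Subgroup (EucGroup (Fin d₁ ⊕ Fin d₂))} {T : Set G}

/-- Common periods make periodic functions a linear space; a period must exist for zero to be
periodic. -/
theorem isPeriodic_of_mem_Uper (hT : HasFinitePeriods T) (hne : (periods T).Nonempty)
    (u : Uper T) : IsPeriodic T (⇑u.1 : G → Eu (Fin d₁ ⊕ Fin d₂)) := by
  obtain ⟨u, hu⟩ := u
  induction hu using Submodule.span_induction with
  | mem u hu => exact hu
  | zero => exact ⟨hne.some, hne.some_mem, fun g t _ => rfl⟩
  | add u w _ _ hu hw => exact hu.comp₂ hT hw fun x y => x + y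
  | smul c u _ hu => exact hu.comp fun x => c • x

/-- The displacement `h ↦ rot(h) u(gh) - u(g)` seen from the point `g`. -/
def relDisp (g : G) : Uper T →L[ℝ] BddPunct G :=
  LinearMap.mkContinuous
    { toFun := fun u => ⟨fun h => h.1.1.linearIsometryEquiv (u.1 (g * h.1)) - u.1 g,
        memℓp_infty ⟨‖u.1‖ + ‖u.1‖, by
          rintro _ ⟨h, rfl⟩
          refine (norm_sub_le _ _).trans (add_le_add ?_ (lp.norm_apply_le_norm (by simp) _ _))
          rw [LinearIsometryEquiv.norm_map]
          exact lp.norm_apply_le_norm (by simp) _ _⟩⟩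
      map_add' := fun u w => by
        apply Subtype.ext
        funext h
        change h.1.1.linearIsometryEquiv (u.1 (g * h.1) + w.1 (g * h.1)) - (u.1 g + w.1 g) =
          (h.1.1.linearIsometryEquiv (u.1 (g * h.1)) - u.1 g) +
          (h.1.1.linearIsometryEquiv (w.1 (g * h.1)) - w.1 g)
        rw [map_add]; abel
      map_smul' := fun c u => by
        apply Subtype.ext
        funext h
        change h.1.1.linearIsometryEquiv (c • u.1 (g * h.1)) - c • u.1 g =
          c • (h.1.1.linearIsometryEquiv (u.1 (g * h.1)) - u.1 g)
        rw [map_smul, smul_sub] } 2 fun u => by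
    refine lp.norm_le_of_forall_le (by positivity) fun h => ?_
    change ‖h.1.1.linearIsometryEquiv (u.1 (g * h.1)) - u.1 g‖ ≤ 2 * ‖u.1‖
    rw [two_mul]
    refine (norm_sub_le _ _).trans (add_le_add ?_ (lp.norm_apply_le_norm (by simp) _ _))
    rw [LinearIsometryEquiv.norm_map]
    exact lp.norm_apply_le_norm (by simp) _ _

theorem relDisp_apply (g : G) (u : Uper T) (h : Punct G) :
    relDisp g u h = h.1.1.linearIsometryEquiv (u.1 (g * h.1)) - u.1 g := rfl

theorem norm_relDisp_le (g : G) : ‖relDisp (T := T) g‖ ≤ 2 :=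
  LinearMap.mkContinuous_norm_le _ (by norm_num) _

theorem isPeriodicWith_relDisp {N : ℕ} (hN : N ∈ periods T) {u : Uper T}
    (hu : IsPeriodicWith T N (⇑u.1 : G → Eu (Fin d₁ ⊕ Fin d₂))) :
    IsPeriodicWith T N fun g => relDisp g u := by
  intro g t ht
  apply Subtype.ext
  funext h
  change h.1.1.linearIsometryEquiv (u.1 (g * t * h.1)) - u.1 (g * t) =
    h.1.1.linearIsometryEquiv (u.1 (g * h.1)) - u.1 g
  rw [hu g t ht, hu.apply_mul_mul hN g h.1 ht]

theorem affineIsometryEquiv_apply_add (g : EucGroup (Fin d₁ ⊕ Fin d₂))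
    (x y : Eu (Fin d₁ ⊕ Fin d₂)) : g (x + y) = g x + g.linearIsometryEquiv y := by
  have := g.map_vadd x y
  rw [vadd_eq_add, vadd_eq_add] at this
  rw [add_comm x, this, add_comm]

variable {V : (Punct G → Eu (Fin d₁ ⊕ Fin d₂)) → ℝ} {x₀ : Eu (Fin d₁ ⊕ Fin d₂)}

/-- The linear part of `g` factors out of every difference, leaving `h x₀ - x₀ + rot(h) u(gh) -
u(g)`, and orthogonal invariance of `V` discards it. -/
theorem potential_conf_eq (hV : IsPotential V) (u : Uper T) (g : G) :
    (V fun h => (g * h.1).1 (x₀ + u.1 (g * h.1)) - g.1 (x₀ + u.1 g)) =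
      V (refConf G x₀ + ⇑(relDisp g u)) := by
  rw [← hV.invariant g.1.linearIsometryEquiv (refConf G x₀ + ⇑(relDisp g u))]
  congr 1
  funext h
  rw [Pi.add_apply, relDisp_apply, refConf]
  change g.1 (h.1.1 (x₀ + u.1 (g * h.1))) - g.1 (x₀ + u.1 g) = _
  rw [← vsub_eq_sub, ← AffineIsometryEquiv.map_vsub, vsub_eq_sub, affineIsometryEquiv_apply_add]
  congr 1
  abel

theorem energy_eq_mean (hT : HasFinitePeriods T) (hne : (periods T).Nonempty) (hV : IsPotential V)
    (u : Uper T) : (energy T V fun g => x₀ + u.1 g) =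
      mean T fun g => V (refConf G x₀ + ⇑(relDisp g u)) := by
  have hw : IsPeriodic T fun g => x₀ + u.1 g :=
    (isPeriodic_of_mem_Uper hT hne u).comp fun x => x₀ + x
  obtain ⟨h1, h2⟩ := hw.period_spec
  have hu : IsPeriodicWith T (period T fun g => x₀ + u.1 g)
      (⇑u.1 : G → Eu (Fin d₁ ⊕ Fin d₂)) := fun g t ht => add_left_cancel (h2 g t ht)
  rw [energy, mean_eq_cosetMean hT h1 fun g t ht =>
    congrArg (fun z : BddPunct G => V (refConf G x₀ + ⇑z)) (isPeriodicWith_relDisp h1 hu g t ht)]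
  simp only [potential_conf_eq hV]

theorem energyHess_apply (hT : HasFinitePeriods T) (hne : (periods T).Nonempty)
    (hV : IsPotential V) (u w : Uper T) :
    energyHess T V x₀ u w =
      mean T fun g => potD2 V (refConf G x₀) (relDisp g u) (relDisp g w) := by
  have hE : (fun u : Uper T => energy T V fun g => x₀ + u.1 g) = fun u : Uper T =>
      mean T fun g => (fun z : BddPunct G => V (refConf G x₀ + ⇑z)) (relDisp g u) :=
    funext fun u => energy_eq_mean hT hne hV u
  have key := fderiv_fderiv_mean (v := fun z : BddPunct G => V (refConf G x₀ + ⇑z))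
    (Λ := relDisp (T := T)) hT (hV.smooth _) two_pos (fun g => norm_relDisp_le g) (fun u => by
      obtain ⟨N, hN, hu⟩ := isPeriodic_of_mem_Uper hT hne u
      exact ⟨N, hN, isPeriodicWith_relDisp hN hu⟩) u w
  exact (congrArg (fun φ : Uper T → ℝ => fderiv ℝ (fderiv ℝ φ) 0 u w) hE).trans key

theorem sq_rigSeminorm (hT : HasFinitePeriods T) (hne : (periods T).Nonempty)
    (K : Submodule ℝ (Matrix (Fin d₁ ⊕ Fin d₂) (Fin d₁ ⊕ Fin d₂) ℝ)) (R : Finset G) (u : Uper T)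
    {N : ℕ} (hN : N ∈ periods T) (hu : IsPeriodicWith T N (⇑u.1 : G → Eu (Fin d₁ ⊕ Fin d₂))) :
    rigSeminorm K T x₀ R ⇑u.1 ^ 2 = cosetMean T N fun g =>
      ‖isoProj K x₀ R (WithLp.toLp 2 fun h : R => u.1 (g * h.1))‖ ^ 2 := by
  have key : ∀ {M : ℕ}, M ∈ periods T →
      IsPeriodicWith T M (⇑u.1 : G → Eu (Fin d₁ ⊕ Fin d₂)) → IsPeriodicWith T M fun g =>
        ‖isoProj K x₀ R (WithLp.toLp 2 fun h : R => u.1 (g * h.1))‖ ^ 2 := by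
    intro M hM hu g t ht
    have : (fun h : R => u.1 (g * t * h.1)) = fun h : R => u.1 (g * h.1) :=
      funext fun h => hu.apply_mul_mul hM g h.1 ht
    exact congrArg (fun w : R → Eu (Fin d₁ ⊕ Fin d₂) =>
      ‖isoProj K x₀ R (WithLp.toLp 2 w)‖ ^ 2) this
  obtain ⟨h1, h2⟩ := (isPeriodic_of_mem_Uper hT hne u).period_spec
  rw [rigSeminorm, Real.sq_sqrt, ← mean_eq_cosetMean hT hN (key hN hu),
    mean_eq_cosetMean hT h1 (key h1 h2)]
  rw [cosetMean]
  exact mul_nonneg (by positivity) (finsum_nonneg fun q => by positivity)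

/-- A function with a period is an element of the space of periodic functions. -/
def toUper (hT : HasFinitePeriods T) {N : ℕ} (hN : N ∈ periods T)
    (u : G → Eu (Fin d₁ ⊕ Fin d₂)) (hu : IsPeriodicWith T N u) : Uper T :=
  ⟨⟨u, memℓp_infty (by
    have h : IsPeriodic T fun g => ‖u g‖ := ⟨N, hN, fun g t ht => congrArg norm (hu g t ht)⟩
    exact (h.finite_range hT).bddAbove)⟩, Submodule.subset_span ⟨N, hN, hu⟩⟩

end

/-! ### Summability of matrix families. -/

section General

variable {Γ : Type} {ι κ μ : Type}

theorem hasSum_of_forall_eq {P M : Type*} [AddCommMonoid M] [TopologicalSpace M] {f f' : P → M}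
    {a : M} (h : HasSum f a) (hf : ∀ x, f' x = f x) : HasSum f' a := by
  rwa [funext hf]

/-- The family is supported on the graph of `k`, which `P` parametrizes. This handles the Kronecker
deltas in `fV`. -/
theorem hasSum_graph {P M : Type*} [AddCommMonoid M] [TopologicalSpace M] [DecidableEq Γ]
    (k : P → Γ) {A : P → M} {S : M} (h : HasSum A S) :
    HasSum (fun q : Γ × P => if q.1 = k q.2 then A q.2 else 0) S := by
  have hi : Function.Injective fun p : P => (k p, p) := fun p q hpq => (Prod.ext_iff.1 hpq).2
  rw [← hi.hasSum_iff]
  · simpa [Function.comp_def] using h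
  · rintro ⟨g, p⟩ hx
    rw [if_neg]
    rintro (rfl : g = k p)
    exact hx ⟨p, rfl⟩

theorem summable_mul_of_bounded_left [Fintype κ] {P : Type*} {H : P → Matrix κ μ ℝ}
    (hH : Summable H) {B : P → Matrix ι κ ℝ} (hB : ∀ p i j, |B p i j| ≤ 1) :
    Summable fun p => B p * H p := by
  refine Pi.summable.2 fun i => Pi.summable.2 fun j => ?_
  simp only [Matrix.mul_apply]
  refine summable_sum fun l _ => ?_
  refine Summable.of_norm_bounded (Pi.summable.1 (Pi.summable.1 hH l) j).abs fun p => ?_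
  rw [Real.norm_eq_abs, abs_mul]
  exact mul_le_of_le_one_left (abs_nonneg _) (hB p i l)

theorem summable_mul_of_bounded_right [Fintype κ] {P : Type*} {H : P → Matrix ι κ ℝ}
    (hH : Summable H) {B : P → Matrix κ μ ℝ} (hB : ∀ p i j, |B p i j| ≤ 1) :
    Summable fun p => H p * B p := by
  have h := (summable_mul_of_bounded_left hH.matrix_transpose (B := fun p => (B p)ᵀ)
    fun p i j => hB p j i).matrix_transpose
  simpa [Matrix.transpose_mul] using h

theorem summable_kronecker_unitaryRep [Group Γ] {P : Type*} {A : P → Matrix κ ι ℝ}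
    (hA : Summable A) {n : ℕ} (ρ : UnitaryRep Γ n) (k : P → Γ) :
    Summable fun p => ((A p).map fun x : ℝ => (x : ℂ)) ⊗ₖ (ρ (k p)).1 := by
  refine Pi.summable.2 fun a => Pi.summable.2 fun b => ?_
  refine Summable.of_norm_bounded (Pi.summable.1 (Pi.summable.1 hA a.1) b.1).abs fun p => ?_
  simp only [Matrix.kroneckerMap_apply, Matrix.map_apply, norm_mul, Complex.norm_real,
    Real.norm_eq_abs]
  exact mul_le_of_le_one_right (abs_nonneg _) (norm_unitaryRep_apply_le_one ρ _ _ _)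

/-- `A ↦ A ⊗ B` from real to complex matrices. -/
def castKronecker {n : ℕ} (B : Matrix (Fin n) (Fin n) ℂ) :
    Matrix κ ι ℝ →+ Matrix (κ × Fin n) (ι × Fin n) ℂ :=
  AddMonoidHom.mk' (fun A => (A.map fun x : ℝ => (x : ℂ)) ⊗ₖ B) fun A A' => by
    ext a b; simp [add_mul]

theorem castKronecker_apply {n : ℕ} (B : Matrix (Fin n) (Fin n) ℂ) (A : Matrix κ ι ℝ) :
    castKronecker B A = (A.map fun x : ℝ => (x : ℂ)) ⊗ₖ B := rfl

theorem continuous_castKronecker {n : ℕ} (B : Matrix (Fin n) (Fin n) ℂ) :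
    Continuous (castKronecker (κ := κ) (ι := ι) B) := by
  refine continuous_pi fun a => continuous_pi fun b => ?_
  exact (Complex.continuous_ofReal.comp (continuous_apply_apply a.1 b.1)).mul continuous_const

end General

/-! ### The Fourier transform of `fV`. -/

section Potential

variable {d₁ d₂ : ℕ}

theorem abs_rot_apply_le (g : EucGroup (Fin d₁ ⊕ Fin d₂)) (i j : Fin d₁ ⊕ Fin d₂) :
    |rot g i j| ≤ 1 := by
  have h := PiLp.norm_apply_le (g.linearIsometryEquiv (EuclideanSpace.single j (1 : ℝ))) i
  simpa [rot] using h

theorem rot_mulVec (g : EucGroup (Fin d₁ ⊕ Fin d₂)) (x : Eu (Fin d₁ ⊕ Fin d₂)) :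
    (rot g *ᵥ fun j => x j) = fun i => g.linearIsometryEquiv x i := by
  funext i
  have hx : x = ∑ j, x j • EuclideanSpace.single j (1 : ℝ) := by
    ext i; cases i <;> simp [Finset.sum_apply, Pi.single_apply]
  conv_rhs => rw [hx]
  simp [Matrix.mulVec, dotProduct, rot, mul_comm]

variable {G : Subgroup (EucGroup (Fin d₁ ⊕ Fin d₂))}
  {V : (Punct G → Eu (Fin d₁ ⊕ Fin d₂)) → ℝ} {x₀ : Eu (Fin d₁ ⊕ Fin d₂)}

theorem abs_apply_le_frobNorm {ι : Type} [Fintype ι] (A : Matrix ι ι ℝ) (i j : ι) :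
    |A i j| ≤ frobNorm A := by
  rw [← Real.sqrt_sq_eq_abs, frobNorm]
  apply Real.sqrt_le_sqrt
  refine le_trans ?_ (Finset.single_le_sum (f := fun i => ∑ j, A i j ^ 2)
    (fun i _ => Finset.sum_nonneg fun j _ => sq_nonneg _) (Finset.mem_univ i))
  exact Finset.single_le_sum (f := fun j => A i j ^ 2) (fun j _ => sq_nonneg _) (Finset.mem_univ j)

theorem IsPotential.summable_partialHess (hV : IsPotential V)
    (y : Punct G → Eu (Fin d₁ ⊕ Fin d₂)) :
    Summable fun p : Punct G × Punct G => partialHess V y p.2 p.1 := by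
  have h := (Equiv.prodComm (Punct G) (Punct G)).summable_iff.2 (hV.summable_hess y)
  exact Pi.summable.2 fun i => Pi.summable.2 fun j =>
    Summable.of_norm_bounded h fun p => abs_apply_le_frobNorm _ i j

theorem IsPotential.partialHess_transpose (hV : IsPotential V)
    (y : Punct G → Eu (Fin d₁ ⊕ Fin d₂)) (g h : Punct G) :
    (partialHess V y g h)ᵀ = partialHess V y h g := by
  ext i j
  exact ((hV.smooth y).contDiffAt.isSymmSndFDerivAt (by simp)).eq _ _

/-- The operator `rot(h) ⊗ ρ(h) - 1`. -/
def dispMatrix {n : ℕ} (ρ : UnitaryRep G n) (h : G) :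
    Matrix ((Fin d₁ ⊕ Fin d₂) × Fin n) ((Fin d₁ ⊕ Fin d₂) × Fin n) ℂ :=
  ((rot h.1).map fun x : ℝ => (x : ℂ)) ⊗ₖ (ρ h).1 - 1

theorem map_ofReal_mul {l m n : Type*} [Fintype m] (A : Matrix l m ℝ) (B : Matrix m n ℝ) :
    ((A * B).map fun x : ℝ => (x : ℂ)) =
      (A.map fun x : ℝ => (x : ℂ)) * B.map fun x : ℝ => (x : ℂ) :=
  Matrix.map_mul (f := Complex.ofRealHom)

theorem conjTranspose_map_ofReal {m n : Type*} (A : Matrix m n ℝ) :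
    (A.map fun x : ℝ => (x : ℂ))ᴴ = Aᵀ.map fun x : ℝ => (x : ℂ) := by
  ext; simp

/-- Expanding the product yields exactly the four terms in the definition of `fV`, each tensored
with `ρ` at the group element selected by its delta. -/
theorem disp_sandwich {n : ℕ} (ρ : UnitaryRep G n) (h₁ h₂ : G)
    (H : Matrix (Fin d₁ ⊕ Fin d₂) (Fin d₁ ⊕ Fin d₂) ℝ) :
    (dispMatrix ρ h₂)ᴴ * ((H.map fun x : ℝ => (x : ℂ)) ⊗ₖ (1 : Matrix (Fin n) (Fin n) ℂ)) *
        dispMatrix ρ h₁ =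
      (((rot h₂.1)ᵀ * H * rot h₁.1).map fun x : ℝ => (x : ℂ)) ⊗ₖ (ρ (h₂⁻¹ * h₁)).1 -
      (((rot h₂.1)ᵀ * H).map fun x : ℝ => (x : ℂ)) ⊗ₖ (ρ h₂⁻¹).1 -
      ((H * rot h₁.1).map fun x : ℝ => (x : ℂ)) ⊗ₖ (ρ h₁).1 +
      (H.map fun x : ℝ => (x : ℂ)) ⊗ₖ (ρ 1).1 := by
  have h1 : (ρ (1 : G)).1 = 1 := by rw [map_one]; rfl
  rw [h1, unitaryRep_mul, unitaryRep_inv, map_ofReal_mul, map_ofReal_mul, map_ofReal_mul,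
    dispMatrix, dispMatrix, Matrix.conjTranspose_sub, Matrix.conjTranspose_one,
    Matrix.conjTranspose_kronecker, conjTranspose_map_ofReal, Matrix.sub_mul, Matrix.one_mul,
    Matrix.mul_sub, Matrix.sub_mul, Matrix.sub_mul, Matrix.mul_one, ← Matrix.mul_kronecker_mul,
    ← Matrix.mul_kronecker_mul, ← Matrix.mul_kronecker_mul, Matrix.mul_one, Matrix.one_mul,
    Matrix.mul_one]
  abel

-- The summand defining `fV` is summable jointly over `g` and the pair of interaction indices, since
-- entries of rotations and of `ρ` are bounded by one. The Fourier series may therefore be summed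
-- over `g` first, which gives the factorized form.
open Classical in
theorem hasSum_fV_aux (hV : IsPotential V) {n : ℕ} (ρ : UnitaryRep G n) :
    Summable (fV V x₀) ∧
    HasSum (fun p : Punct G × Punct G => (dispMatrix ρ p.2.1)ᴴ *
      (((partialHess V (refConf G x₀) p.2 p.1).map fun x : ℝ => (x : ℂ)) ⊗ₖ
        (1 : Matrix (Fin n) (Fin n) ℂ)) * dispMatrix ρ p.1.1) (fourier (fV V x₀) ρ) := by
  set H : Punct G × Punct G → Matrix (Fin d₁ ⊕ Fin d₂) (Fin d₁ ⊕ Fin d₂) ℝ :=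
    fun p => partialHess V (refConf G x₀) p.2 p.1
  have hH : Summable H := hV.summable_partialHess _
  have h2 : Summable fun p => (rot p.2.1.1)ᵀ * H p :=
    summable_mul_of_bounded_left hH fun p i j => abs_rot_apply_le _ j i
  have h1 : Summable fun p => (rot p.2.1.1)ᵀ * H p * rot p.1.1.1 :=
    summable_mul_of_bounded_right h2 fun p i j => abs_rot_apply_le _ i j
  have h3 : Summable fun p => H p * rot p.1.1.1 :=
    summable_mul_of_bounded_right hH fun p i j => abs_rot_apply_le _ i j
  let F : G × (Punct G × Punct G) → Matrix (Fin d₁ ⊕ Fin d₂) (Fin d₁ ⊕ Fin d₂) ℝ := fun q =>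
    ((if q.1 = q.2.2.1⁻¹ * q.2.1.1 then (rot q.2.2.1.1)ᵀ * H q.2 * rot q.2.1.1.1 else 0)
      - (if q.1 = q.2.2.1⁻¹ then (rot q.2.2.1.1)ᵀ * H q.2 else 0)
      - (if q.1 = q.2.1.1 then H q.2 * rot q.2.1.1.1 else 0)
      + (if q.1 = 1 then H q.2 else 0))
  have hF : Summable F :=
    ((((hasSum_graph (fun p : Punct G × Punct G => p.2.1⁻¹ * p.1.1) h1.hasSum).sub
      (hasSum_graph (fun p : Punct G × Punct G => p.2.1⁻¹) h2.hasSum)).sub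
      (hasSum_graph (fun p : Punct G × Punct G => p.1.1) h3.hasSum)).add
      (hasSum_graph (fun _ : Punct G × Punct G => (1 : G)) hH.hasSum)).summable
  have hFg : ∀ g, HasSum (fun p => F (g, p)) (fV V x₀ g) := fun g => (hF.prod_factor g).hasSum
  have hfV : Summable (fV V x₀) := (hF.hasSum.prod_fiberwise hFg).summable
  refine ⟨hfV, ?_⟩
  obtain ⟨S1, k1⟩ := summable_kronecker_unitaryRep h1 ρ fun p => p.2.1⁻¹ * p.1.1
  obtain ⟨S2, k2⟩ := summable_kronecker_unitaryRep h2 ρ fun p => p.2.1⁻¹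
  obtain ⟨S3, k3⟩ := summable_kronecker_unitaryRep h3 ρ fun p => p.1.1
  obtain ⟨S4, k4⟩ := summable_kronecker_unitaryRep hH ρ fun p => 1
  have hS := ((k1.sub k2).sub k3).add k4
  have hS' := (((hasSum_graph (fun p : Punct G × Punct G => p.2.1⁻¹ * p.1.1) k1).sub
      (hasSum_graph (fun p : Punct G × Punct G => p.2.1⁻¹) k2)).sub
      (hasSum_graph (fun p : Punct G × Punct G => p.1.1) k3)).add
      (hasSum_graph (fun _ : Punct G × Punct G => (1 : G)) k4)
  have hfib : ∀ g, HasSum (fun p => castKronecker (ρ g).1 (F (g, p)))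
      (castKronecker (ρ g).1 (fV V x₀ g)) := fun g =>
    (hFg g).map _ (continuous_castKronecker _)
  have hS'' : HasSum (fun q : G × (Punct G × Punct G) => castKronecker (ρ q.1).1 (F q))
      (S1 - S2 - S3 + S4) := by
    refine hasSum_of_forall_eq hS' fun q => ?_
    simp only [F, map_add, map_sub]
    have : ∀ (k : G) (A : Matrix (Fin d₁ ⊕ Fin d₂) (Fin d₁ ⊕ Fin d₂) ℝ),
        castKronecker (ρ q.1).1 (if q.1 = k then A else 0) =
          if q.1 = k then (A.map fun x : ℝ => (x : ℂ)) ⊗ₖ (ρ k).1 else 0 := by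
      intro k A
      split_ifs with h
      · rw [castKronecker_apply, h]
      · exact map_zero _
    simp only [this]
  -- The fibre over `g` sums to `fV(g) ⊗ ρ(g)`, while the total was found along the graphs.
  rw [show fourier (fV V x₀) ρ = S1 - S2 - S3 + S4 from (hS''.prod_fiberwise hfib).tsum_eq]
  refine hasSum_of_forall_eq hS fun p => ?_
  exact disp_sandwich ρ p.1.1 p.2.1 (H p)

theorem summable_fV (hV : IsPotential V) : Summable (fV V x₀) :=
  (hasSum_fV_aux hV (1 : UnitaryRep G 0)).1

theorem hasSum_fourier_fV (hV : IsPotential V) {n : ℕ} (ρ : UnitaryRep G n) :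
    HasSum (fun p : Punct G × Punct G => (dispMatrix ρ p.2.1)ᴴ *
      (((partialHess V (refConf G x₀) p.2 p.1).map fun x : ℝ => (x : ℂ)) ⊗ₖ
        (1 : Matrix (Fin n) (Fin n) ℂ)) * dispMatrix ρ p.1.1) (fourier (fV V x₀) ρ) :=
  (hasSum_fV_aux hV ρ).2

/-- Taking adjoints exchanges the two indices of the factorized sum, by symmetry of second
derivatives. -/
theorem isHermitian_fourier_fV (hV : IsPotential V) {n : ℕ} (ρ : UnitaryRep G n) :
    (fourier (fV V x₀) ρ).IsHermitian := by
  have h := hasSum_fourier_fV (x₀ := x₀) hV ρ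
  have h' := (Equiv.prodComm (Punct G) (Punct G)).hasSum_iff.2 h.matrix_conjTranspose
  refine h'.unique ?_
  convert h using 2 with p
  simp only [Function.comp_apply, Equiv.prodComm_apply, Prod.fst_swap, Prod.snd_swap,
    Matrix.conjTranspose_mul, Matrix.conjTranspose_conjTranspose, Matrix.conjTranspose_kronecker,
    Matrix.conjTranspose_one, conjTranspose_map_ofReal, hV.partialHess_transpose]
  rw [Matrix.mul_assoc]

end Potential

/-! ### Periodic functions as vectors. -/

section CosetVec

variable {Γ : Type} [Group Γ] (H : Subgroup Γ) [Finite (Γ ⧸ H)] {κ : Type}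

/-- A function on the group as a vector with entries indexed by the cosets. -/
def cosetVec (u : Γ → κ → ℝ) : κ × Fin (Nat.card (Γ ⧸ H)) → ℂ :=
  fun p => (u ((Finite.equivFin (Γ ⧸ H)).symm p.2).out p.1 : ℂ)

theorem star_cosetVec_dotProduct [Fintype κ] [Fintype (Γ ⧸ H)] (u w : Γ → κ → ℝ) :
    star (cosetVec H u) ⬝ᵥ cosetVec H w = ((∑ q : Γ ⧸ H, u q.out ⬝ᵥ w q.out : ℝ) : ℂ) := by
  rw [← (Finite.equivFin (Γ ⧸ H)).symm.sum_comp]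
  simp only [dotProduct, Fintype.sum_prod_type_right, cosetVec, Pi.star_apply, Complex.star_def,
    Complex.conj_ofReal, Complex.ofReal_sum, Complex.ofReal_mul]

end CosetVec

/-! ### The regular representation of a finite quotient. -/

section Regular

variable {Γ : Type} [Group Γ] (H : Subgroup Γ) [H.Normal] [Finite (Γ ⧸ H)]

open Classical in
/-- The matrix of right translation by `k` on functions on the quotient. -/
def regMatrix (k : Γ) : Matrix (Fin (Nat.card (Γ ⧸ H))) (Fin (Nat.card (Γ ⧸ H))) ℂ :=
  Matrix.of fun a b => if Finite.equivFin (Γ ⧸ H) ((Finite.equivFin (Γ ⧸ H)).symm a * k) = b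
    then 1 else 0

theorem regMatrix_mulVec (k : Γ) (x : Fin (Nat.card (Γ ⧸ H)) → ℂ) (a : Fin (Nat.card (Γ ⧸ H))) :
    (regMatrix H k *ᵥ x) a =
      x (Finite.equivFin (Γ ⧸ H) ((Finite.equivFin (Γ ⧸ H)).symm a * k)) := by
  simp [regMatrix, Matrix.mulVec, dotProduct]

theorem regMatrix_mul (k l : Γ) : regMatrix H (k * l) = regMatrix H k * regMatrix H l :=
  eq_of_mulVec_eq fun w => by
    funext a
    rw [← Matrix.mulVec_mulVec, regMatrix_mulVec, regMatrix_mulVec, regMatrix_mulVec]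
    simp [mul_assoc]

/-- The right regular representation of the quotient by a normal subgroup of finite index. -/
def regRep : UnitaryRep Γ (Nat.card (Γ ⧸ H)) :=
  MonoidHom.mk' (fun k => ⟨regMatrix H k, by
    rw [Matrix.mem_unitaryGroup_iff]
    ext a b
    simp [Matrix.mul_apply, regMatrix, Matrix.one_apply, eq_comm]⟩) fun k l =>
    Subtype.ext (regMatrix_mul H k l)

theorem coe_regRep (k : Γ) : (regRep H k).1 = regMatrix H k := rfl

variable {H} {κ ι : Type}

/-- This is where algebra meets analysis: convolution-type operators on periodic functions are
Fourier transforms at the regular representation. -/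
theorem kronecker_regRep_mulVec_cosetVec [Fintype ι] {u : Γ → ι → ℝ}
    (hu : ∀ g h : Γ, (g : Γ ⧸ H) = h → u g = u h) (A : Matrix κ ι ℝ) (k : Γ) :
    ((A.map fun x : ℝ => (x : ℂ)) ⊗ₖ (regRep H k).1) *ᵥ cosetVec H u =
      cosetVec H fun g => A *ᵥ u (g * k) := by
  funext p
  have h1 : ∀ j, ∑ b, (regRep H k).1 p.2 b * cosetVec H u (j, b) =
      (u (((Finite.equivFin (Γ ⧸ H)).symm p.2).out * k) j : ℂ) := by
    intro j
    have := regMatrix_mulVec H k (fun b => cosetVec H u (j, b)) p.2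
    rw [coe_regRep]
    refine this.trans ?_
    rw [cosetVec, Equiv.symm_apply_apply, hu]
    simp
  simp only [Matrix.mulVec, dotProduct, Fintype.sum_prod_type, Matrix.kroneckerMap_apply,
    Matrix.map_apply, mul_assoc, ← Finset.mul_sum, h1]
  simp [cosetVec, Matrix.mulVec, dotProduct]

variable {f : Γ → Matrix ι ι ℝ} {g : Γ → Matrix κ ι ℝ}

/-- The `a`-th row of matrix coefficients, `Φ_a(q, b) = ρ(q)_{ab}`, intertwines `ρ` with the regular
representation, and `∑ Φ_aᴴ Φ_a = ∑_q ρ(q)ᴴ ρ(q)` is the order of the quotient times the identity.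
Irreducibility plays no role. -/
theorem PosSemidef_stabMatrix_of_regRep [Fintype κ] [Fintype ι] [DecidableEq κ] [DecidableEq ι]
    (hf : Summable f) (hg : Summable g) {c : ℝ}
    (hreg : (stabMatrix f g c (regRep H)).PosSemidef) {n : ℕ} (ρ : UnitaryRep Γ n)
    (hρ : ∀ g h : Γ, (g : Γ ⧸ H) = h → ρ g = ρ h) : (stabMatrix f g c ρ).PosSemidef := by
  have := Fintype.ofFinite (Γ ⧸ H)
  let Φ : Fin n → Matrix (Fin (Nat.card (Γ ⧸ H))) (Fin n) ℂ := fun a =>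
    Matrix.of fun q b => (ρ ((Finite.equivFin (Γ ⧸ H)).symm q).out).1 a b
  have hΦ : ∀ a, Intertwines (regRep H) ρ (Φ a) := by
    intro a k
    ext q b
    have h1 := regMatrix_mulVec H k (fun q => Φ a q b) q
    refine h1.trans ?_
    have h2 : ρ (Quotient.out ((Finite.equivFin (Γ ⧸ H)).symm q * (k : Γ ⧸ H))) =
        ρ (((Finite.equivFin (Γ ⧸ H)).symm q).out * k) := hρ _ _ (by simp)
    simp only [Φ, Matrix.of_apply, Equiv.symm_apply_apply, h2]
    rw [unitaryRep_mul, Matrix.mul_apply, Matrix.mul_apply]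
    rfl
  refine PosSemidef_stabMatrix_of_sum hf hg (r := Nat.card (Γ ⧸ H))
    (Nat.cast_pos.2 Nat.card_pos) (fun _ : Fin n => regRep H) (fun a => (Φ a)ᴴ)
    (fun a => (hΦ a).conjTranspose) ?_ fun _ => hreg
  ext b b'
  have h2 : ∀ k, ∑ a, star ((ρ k).1 a b) * (ρ k).1 a b' = (1 : Matrix (Fin n) (Fin n) ℂ) b b' := by
    intro k
    have h := congrFun (congrFun (Matrix.mem_unitaryGroup_iff'.1 (ρ k).2) b) b'
    rw [Matrix.mul_apply] at h
    exact h
  simp only [Matrix.sum_apply, Matrix.mul_apply, Matrix.conjTranspose_apply, Φ, Matrix.of_apply,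
    Matrix.smul_apply, star_star]
  rw [Finset.sum_comm]
  simp only [h2]
  simp

/-- The regular representation consists of permutation matrices, so every summand is real. -/
theorem exists_real_fourier_regRep {u : Γ → Matrix κ ι ℝ} (hu : Summable u) :
    ∃ F : Matrix (κ × Fin (Nat.card (Γ ⧸ H))) (ι × Fin (Nat.card (Γ ⧸ H))) ℝ,
      fourier u (regRep H) = F.map fun x : ℝ => (x : ℂ) := by
  refine ⟨(fourier u (regRep H)).map Complex.re, ?_⟩
  have him : ∀ a b, (fourier u (regRep H) a b).im = 0 := by
    intro a b
    have h := Complex.imCLM.hasSum (Pi.hasSum.1 (Pi.hasSum.1 (hasSum_fourier hu (regRep H)) a) b)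
    refine h.unique ?_
    convert hasSum_zero with k
    simp only [Matrix.kroneckerMap_apply, Matrix.map_apply, Complex.imCLM_apply, coe_regRep,
      regMatrix, Matrix.of_apply]
    split_ifs <;> simp
  ext a b
  exact Complex.ext (by simp) (by simp [him])

theorem exists_real_stabMatrix_regRep [Fintype κ] (hf : Summable f) (hg : Summable g) (c : ℝ) :
    ∃ M : Matrix (ι × Fin (Nat.card (Γ ⧸ H))) (ι × Fin (Nat.card (Γ ⧸ H))) ℝ,
      stabMatrix f g c (regRep H) = M.map fun x : ℝ => (x : ℂ) := by
  obtain ⟨F, hF⟩ := exists_real_fourier_regRep (H := H) hf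
  obtain ⟨E, hE⟩ := exists_real_fourier_regRep (H := H) hg
  refine ⟨F - c • (Eᵀ * E), ?_⟩
  rw [stabMatrix, hF, hE, conjTranspose_map_ofReal, ← map_ofReal_mul]
  ext a b
  simp

theorem PosSemidef_map_ofReal {n : Type*} [Finite n] {M : Matrix n n ℝ} (hM : M.PosSemidef) :
    (M.map fun x : ℝ => (x : ℂ)).PosSemidef := by
  obtain ⟨m, v, rfl⟩ := Matrix.posSemidef_iff_eq_sum_vecMulVec.1 hM
  have : ((∑ i, Matrix.vecMulVec (v i) (star (v i))).map fun x : ℝ => (x : ℂ)) =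
      ∑ i, Matrix.vecMulVec (fun a => (v i a : ℂ)) (star fun a => (v i a : ℂ)) := by
    ext a b
    simp [Matrix.sum_apply, Matrix.vecMulVec_apply]
  rw [this]
  exact Matrix.posSemidef_sum _ fun i _ => Matrix.posSemidef_vecMulVec_self_star _

theorem _root_.HasSum.matrix_mulVec {α l m : Type*} [Fintype m] {f : α → Matrix l m ℂ}
    {a : Matrix l m ℂ} (h : HasSum f a) (x : m → ℂ) : HasSum (fun k => f k *ᵥ x) (a *ᵥ x) :=
  h.map (AddMonoidHom.mk' (fun M : Matrix l m ℂ => M *ᵥ x) fun A B => Matrix.add_mulVec A B x)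
    (continuous_id.matrix_mulVec continuous_const)

theorem _root_.HasSum.dotProduct_matrix_mulVec {α l m : Type*} [Fintype l] [Fintype m]
    {f : α → Matrix l m ℂ} {a : Matrix l m ℂ} (h : HasSum f a) (y : l → ℂ) (x : m → ℂ) :
    HasSum (fun k => y ⬝ᵥ (f k *ᵥ x)) (y ⬝ᵥ (a *ᵥ x)) :=
  (h.matrix_mulVec x).map (AddMonoidHom.mk' (fun z => y ⬝ᵥ z) (dotProduct_add y))
    (continuous_const.dotProduct continuous_id)

theorem kronecker_one_mulVec_cosetVec {u : Γ → ι → ℝ}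
    (hu : ∀ g h : Γ, (g : Γ ⧸ H) = h → u g = u h) (A : Matrix κ ι ℝ) [Fintype ι] :
    ((A.map fun x : ℝ => (x : ℂ)) ⊗ₖ (1 : Matrix (Fin (Nat.card (Γ ⧸ H)))
      (Fin (Nat.card (Γ ⧸ H))) ℂ)) *ᵥ cosetVec H u = cosetVec H fun g => A *ᵥ u g := by
  have h := kronecker_regRep_mulVec_cosetVec hu A 1
  simp only [mul_one] at h
  rw [← h, map_one]
  rfl

theorem star_ofReal_dotProduct_mulVec {n : Type*} [Fintype n] (M : Matrix n n ℝ) (x : n → ℝ) :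
    star (fun p => (x p : ℂ)) ⬝ᵥ
      ((M.map fun x : ℝ => (x : ℂ)) *ᵥ fun p => (x p : ℂ)) = ((x ⬝ᵥ (M *ᵥ x) : ℝ) : ℂ) := by
  simp [dotProduct, Matrix.mulVec]

theorem star_dotProduct_stabMatrix_mulVec [Fintype κ] [Fintype ι] (f : Γ → Matrix ι ι ℝ)
    (g : Γ → Matrix κ ι ℝ) (c : ℝ) {n : ℕ} (ρ : UnitaryRep Γ n) (x : ι × Fin n → ℂ) :
    star x ⬝ᵥ (stabMatrix f g c ρ *ᵥ x) = star x ⬝ᵥ (fourier f ρ *ᵥ x) -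
      c * (star (fourier g ρ *ᵥ x) ⬝ᵥ (fourier g ρ *ᵥ x)) := by
  rw [stabMatrix, Matrix.sub_mulVec, dotProduct_sub, Matrix.smul_mulVec, dotProduct_smul,
    ← Matrix.mulVec_mulVec, Matrix.dotProduct_mulVec _ (fourier g ρ)ᴴ, ← Matrix.star_mulVec,
    smul_eq_mul]

theorem star_dotProduct_sandwich_mulVec [Fintype ι] [Fintype (Γ ⧸ H)]
    {A B : Matrix (ι × Fin (Nat.card (Γ ⧸ H))) (ι × Fin (Nat.card (Γ ⧸ H))) ℂ}
    {x : ι × Fin (Nat.card (Γ ⧸ H)) → ℂ} {y z : Γ → ι → ℝ} (hA : A *ᵥ x = cosetVec H y)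
    (hB : B *ᵥ x = cosetVec H z) (hz : ∀ g h : Γ, (g : Γ ⧸ H) = h → z g = z h)
    (M : Matrix ι ι ℝ) :
    star x ⬝ᵥ ((Aᴴ * ((M.map fun x : ℝ => (x : ℂ)) ⊗ₖ (1 : Matrix (Fin (Nat.card (Γ ⧸ H)))
      (Fin (Nat.card (Γ ⧸ H))) ℂ)) * B) *ᵥ x) =
      ((∑ q : Γ ⧸ H, y q.out ⬝ᵥ (M *ᵥ z q.out) : ℝ) : ℂ) := by
  rw [Matrix.mul_assoc, ← Matrix.mulVec_mulVec, ← Matrix.mulVec_mulVec, Matrix.dotProduct_mulVec _ Aᴴ,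
    ← Matrix.star_mulVec, hA, hB, kronecker_one_mulVec_cosetVec hz, star_cosetVec_dotProduct]

theorem star_dotProduct_stabMatrix_regRep_mulVec [Fintype κ] [Fintype ι] [Fintype (Γ ⧸ H)] {c a : ℝ}
    {x : ι × Fin (Nat.card (Γ ⧸ H)) → ℂ} {w : Γ → κ → ℝ}
    (hf : star x ⬝ᵥ (fourier f (regRep H) *ᵥ x) = (a : ℂ))
    (hg : fourier g (regRep H) *ᵥ x = cosetVec H w) :
    star x ⬝ᵥ (stabMatrix f g c (regRep H) *ᵥ x) =
      ((a - c * ∑ q : Γ ⧸ H, w q.out ⬝ᵥ w q.out : ℝ) : ℂ) := by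
  rw [star_dotProduct_stabMatrix_mulVec, hf, hg, star_cosetVec_dotProduct, Complex.ofReal_sub,
    Complex.ofReal_mul]

/-- The matrix is real and symmetric, so nonnegativity on real vectors suffices, and every real
vector comes from a function constant on cosets. -/
theorem PosSemidef_stabMatrix_regRep_of_forall [Fintype κ] [Fintype ι] (hf : Summable f)
    (hg : Summable g) {c : ℝ} (hherm : (fourier f (regRep H)).IsHermitian)
    (hnonneg : ∀ y : Γ → ι → ℝ, (∀ g h : Γ, (g : Γ ⧸ H) = h → y g = y h) →
      0 ≤ star (cosetVec H y) ⬝ᵥ (stabMatrix f g c (regRep H) *ᵥ cosetVec H y)) :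
    (stabMatrix f g c (regRep H)).PosSemidef := by
  obtain ⟨M, hM⟩ := exists_real_stabMatrix_regRep (H := H) hf hg c
  have hherm : (stabMatrix f g c (regRep H)).IsHermitian := by
    refine hherm.sub ?_
    rw [Matrix.IsHermitian, Matrix.conjTranspose_smul,
      (Matrix.isHermitian_conjTranspose_mul_self _).eq, Complex.star_def, Complex.conj_ofReal]
  rw [hM]
  refine PosSemidef_map_ofReal (Matrix.posSemidef_iff_dotProduct_mulVec.2 ⟨?_, fun x => ?_⟩)
  · ext a b
    have h := congrFun (congrFun hherm a) b
    rw [hM] at h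
    simpa using h
  · have h := hnonneg (fun g i => x (i, Finite.equivFin (Γ ⧸ H) (g : Γ ⧸ H)))
      fun g h hgh => by simp only [hgh]
    have hx : (cosetVec H fun g i => x (i, Finite.equivFin (Γ ⧸ H) (g : Γ ⧸ H))) =
        fun p => (x p : ℂ) := by
      funext p
      simp [cosetVec]
    rw [hM, hx, star_ofReal_dotProduct_mulVec, Complex.zero_le_real] at h
    rwa [star_trivial]

end Regular

/-! ### The Fourier side of the rigidity seminorm. -/

section Projection

variable {d₁ d₂ : ℕ} {G : Subgroup (EucGroup (Fin d₁ ⊕ Fin d₂))}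
  (K : Submodule ℝ (Matrix (Fin d₁ ⊕ Fin d₂) (Fin d₁ ⊕ Fin d₂) ℝ))
  (x₀ : Eu (Fin d₁ ⊕ Fin d₂)) (R : Finset G)

theorem gProj_eq_zero {g : G} (hg : g ∉ R) : gProj K x₀ R g = 0 := by
  classical
  have : (Matrix.of fun (a : R × (Fin d₁ ⊕ Fin d₂)) (j : Fin d₁ ⊕ Fin d₂) =>
      if g = a.1.1 ∧ a.2 = j then (1 : ℝ) else 0) = 0 := by
    ext a j
    rw [Matrix.of_apply, if_neg]
    · rfl
    · rintro ⟨rfl, -⟩; exact hg a.1.2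
  rw [gProj]
  convert Matrix.mul_zero _

theorem summable_gProj : Summable (gProj K x₀ R) :=
  summable_of_ne_finset_zero (s := R) fun _ hg => gProj_eq_zero K x₀ R hg

theorem projMatrix_mulVec (w : R → Eu (Fin d₁ ⊕ Fin d₂)) (a : R × (Fin d₁ ⊕ Fin d₂)) :
    (projMatrix K x₀ R *ᵥ fun b => w b.1 b.2) a =
      isoProj K x₀ R (WithLp.toLp 2 w) a.1 a.2 := by
  classical
  have hw : (WithLp.toLp 2 w : Loc R) = ∑ b : R × (Fin d₁ ⊕ Fin d₂), w b.1 b.2 •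
      (WithLp.toLp 2 (Pi.single b.1 (EuclideanSpace.single b.2 1)) : Loc R) := by
    ext h i
    simp only [WithLp.ofLp_sum, Finset.sum_apply, WithLp.ofLp_smul, Pi.smul_apply, smul_eq_mul]
    rw [Finset.sum_eq_single (h, i)]
    · simp
    · rintro ⟨h', i'⟩ - hne
      by_cases hh : h' = h
      · subst hh
        have : i' ≠ i := fun hi => hne (by rw [hi])
        simp [this.symm]
      · simp [Pi.single_eq_of_ne (Ne.symm hh)]
    · simp
  rw [hw, map_sum]
  simp only [map_smul, WithLp.ofLp_sum, Finset.sum_apply, WithLp.ofLp_smul, Pi.smul_apply,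
    smul_eq_mul, Matrix.mulVec, dotProduct, projMatrix, Matrix.of_apply]
  refine Finset.sum_congr rfl fun b _ => ?_
  rw [mul_comm]

/-- Summing over `k` collects the blocks `δ_{k,h} w(k)` into the restriction of `w` to `R`, to which
the projection is then applied. -/
theorem sum_gProj_mulVec (w : G → Eu (Fin d₁ ⊕ Fin d₂)) (a : R × (Fin d₁ ⊕ Fin d₂)) :
    ∑ k ∈ R, (gProj K x₀ R k *ᵥ fun j => w k j) a =
      isoProj K x₀ R (WithLp.toLp 2 fun h : R => w h.1) a.1 a.2 := by
  classical
  rw [← projMatrix_mulVec]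
  simp only [gProj, ← Matrix.mulVec_mulVec]
  rw [← Finset.sum_apply, ← Matrix.mulVec_sum]
  congr 2
  funext b
  simp only [Finset.sum_apply, Matrix.mulVec, dotProduct, Matrix.of_apply, ite_mul, one_mul,
    zero_mul, ite_and]
  rw [Finset.sum_eq_single b.1.1]
  · simp
  · intro k _ hk; simp [hk]
  · intro h; exact absurd b.1.2 h

end Projection

/-! ### The quadratic form at the regular representation. -/

section QuadraticForm

variable {d₁ d₂ : ℕ} {G : Subgroup (EucGroup (Fin d₁ ⊕ Fin d₂))} {T : Set G}
  {V : (Punct G → Eu (Fin d₁ ⊕ Fin d₂)) → ℝ} {x₀ : Eu (Fin d₁ ⊕ Fin d₂)} {N : ℕ}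
  [(powSubgroup T N).Normal] [Finite (G ⧸ powSubgroup T N)]

theorem dispMatrix_mulVec_cosetVec (hN : N ∈ periods T) {u : Uper T}
    (hu : IsPeriodicWith T N (⇑u.1 : G → Eu (Fin d₁ ⊕ Fin d₂))) (h : Punct G) :
    dispMatrix (regRep (powSubgroup T N)) h.1 *ᵥ cosetVec (powSubgroup T N) (fun g i => u.1 g i) =
      cosetVec (powSubgroup T N) fun g i => relDisp g u h i := by
  rw [dispMatrix, Matrix.sub_mulVec, Matrix.one_mulVec, kronecker_regRep_mulVec_cosetVec
    fun g k hgk => by rw [hu.eq_of_mk_eq hN hgk]]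
  funext p
  simp only [cosetVec, Pi.sub_apply, rot_mulVec, relDisp_apply, PiLp.sub_apply, Complex.ofReal_sub]

theorem disp_sandwich_quadratic [Fintype (G ⧸ powSubgroup T N)] (hN : N ∈ periods T) {u : Uper T}
    (hu : IsPeriodicWith T N (⇑u.1 : G → Eu (Fin d₁ ⊕ Fin d₂))) (h₁ h₂ : Punct G)
    (H : Matrix (Fin d₁ ⊕ Fin d₂) (Fin d₁ ⊕ Fin d₂) ℝ) :
    star (cosetVec (powSubgroup T N) fun g i => u.1 g i) ⬝ᵥ
        (((dispMatrix (regRep (powSubgroup T N)) h₂.1)ᴴ *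
          ((H.map fun x : ℝ => (x : ℂ)) ⊗ₖ (1 : Matrix (Fin (Nat.card (G ⧸ powSubgroup T N)))
            (Fin (Nat.card (G ⧸ powSubgroup T N))) ℂ)) *
          dispMatrix (regRep (powSubgroup T N)) h₁.1) *ᵥ
          cosetVec (powSubgroup T N) fun g i => u.1 g i) =
      ((∑ q : G ⧸ powSubgroup T N, (fun i => relDisp q.out u h₂ i) ⬝ᵥ
        (H *ᵥ fun j => relDisp q.out u h₁ j) : ℝ) : ℂ) := by
  have hper : ∀ g k : G, (g : G ⧸ powSubgroup T N) = k →
      (fun i => relDisp g u h₁ i) = fun i => relDisp k u h₁ i := fun g k hgk => by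
    have h : relDisp g u = relDisp k u := (isPeriodicWith_relDisp hN hu).eq_of_mk_eq hN hgk
    rw [h]
  exact star_dotProduct_sandwich_mulVec (dispMatrix_mulVec_cosetVec hN hu h₂)
    (dispMatrix_mulVec_cosetVec hN hu h₁) hper H

/-- Each factorized term contributes a sum over cosets of displacement products. The series
representation of `V''(y₀)`, applied to the relative displacements, identifies the total. -/
theorem fourier_fV_quadratic (hV : IsPotential V) (hV0 : HessianIsSum V (refConf G x₀))
    [Fintype (G ⧸ powSubgroup T N)] (hN : N ∈ periods T) {u : Uper T}
    (hu : IsPeriodicWith T N (⇑u.1 : G → Eu (Fin d₁ ⊕ Fin d₂))) :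
    star (cosetVec (powSubgroup T N) fun g i => u.1 g i) ⬝ᵥ
        (fourier (fV V x₀) (regRep (powSubgroup T N)) *ᵥ
          cosetVec (powSubgroup T N) fun g i => u.1 g i) =
      ((∑ q : G ⧸ powSubgroup T N,
        potD2 V (refConf G x₀) (relDisp q.out u) (relDisp q.out u) : ℝ) : ℂ) := by
  have h3 : HasSum (fun p : Punct G × Punct G => ∑ q : G ⧸ powSubgroup T N,
      (fun i => relDisp q.out u p.2 i) ⬝ᵥ
        (partialHess V (refConf G x₀) p.2 p.1 *ᵥ fun j => relDisp q.out u p.1 j))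
      (∑ q : G ⧸ powSubgroup T N,
        potD2 V (refConf G x₀) (relDisp q.out u) (relDisp q.out u)) :=
    hasSum_sum fun q _ => hasSum_of_forall_eq ((Equiv.prodComm (Punct G) (Punct G)).hasSum_iff.2
      (hV0 (relDisp q.out u) (relDisp q.out u))) fun p => rfl
  refine ((hasSum_fourier_fV (x₀ := x₀) hV (regRep (powSubgroup T N))).dotProduct_matrix_mulVec
    _ _).unique (hasSum_of_forall_eq (Complex.hasSum_ofReal.2 h3) fun p => ?_)
  exact disp_sandwich_quadratic hN hu p.1 p.2 _

theorem fourier_gProj_mulVec_cosetVec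
    (K : Submodule ℝ (Matrix (Fin d₁ ⊕ Fin d₂) (Fin d₁ ⊕ Fin d₂) ℝ)) (R : Finset G)
    (hN : N ∈ periods T) {u : Uper T}
    (hu : IsPeriodicWith T N (⇑u.1 : G → Eu (Fin d₁ ⊕ Fin d₂))) :
    fourier (gProj K x₀ R) (regRep (powSubgroup T N)) *ᵥ
        (cosetVec (powSubgroup T N) fun g i => u.1 g i) =
      cosetVec (powSubgroup T N) fun g (a : R × (Fin d₁ ⊕ Fin d₂)) =>
        isoProj K x₀ R (WithLp.toLp 2 fun h : R => u.1 (g * h.1)) a.1 a.2 := by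
  have h1 := (hasSum_fourier (summable_gProj K x₀ R) (regRep (powSubgroup T N))).matrix_mulVec
    (cosetVec (powSubgroup T N) fun g i => u.1 g i)
  have h2 : ∀ k, ((gProj K x₀ R k).map fun x : ℝ => (x : ℂ)) ⊗ₖ
      (regRep (powSubgroup T N) k).1 *ᵥ (cosetVec (powSubgroup T N) fun g i => u.1 g i) =
      cosetVec (powSubgroup T N) fun g => gProj K x₀ R k *ᵥ fun i => u.1 (g * k) i := fun k =>
    kronecker_regRep_mulVec_cosetVec (fun g k hgk => by rw [hu.eq_of_mk_eq hN hgk]) _ _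
  simp only [h2] at h1
  refine h1.unique ?_
  have h3 : cosetVec (powSubgroup T N) (fun g (a : R × (Fin d₁ ⊕ Fin d₂)) =>
      isoProj K x₀ R (WithLp.toLp 2 fun h : R => u.1 (g * h.1)) a.1 a.2) =
      ∑ k ∈ R, cosetVec (powSubgroup T N) fun g =>
        gProj K x₀ R k *ᵥ fun i => u.1 (g * k) i := by
    funext p
    simp only [Finset.sum_apply, cosetVec]
    rw [← Complex.ofReal_sum, sum_gProj_mulVec K x₀ R fun k => u.1 (_ * k)]
  rw [h3]
  refine hasSum_sum_of_ne_finset_zero fun k hk => ?_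
  funext p
  simp [gProj_eq_zero K x₀ R hk, cosetVec]

omit [(powSubgroup T N).Normal] in
theorem card_mul_energyHess (hT : HasFinitePeriods T) (hV : IsPotential V)
    [Fintype (G ⧸ powSubgroup T N)] (hN : N ∈ periods T) {u : Uper T}
    (hu : IsPeriodicWith T N (⇑u.1 : G → Eu (Fin d₁ ⊕ Fin d₂))) :
    Nat.card (G ⧸ powSubgroup T N) * energyHess T V x₀ u u = ∑ q : G ⧸ powSubgroup T N,
      potD2 V (refConf G x₀) (relDisp q.out u) (relDisp q.out u) := by
  have hper : IsPeriodicWith T N fun g =>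
      potD2 V (refConf G x₀) (relDisp g u) (relDisp g u) := fun g t ht =>
    congrArg (fun z : BddPunct G => potD2 V (refConf G x₀) z z)
      (isPeriodicWith_relDisp hN hu g t ht)
  have hcard : (Nat.card (G ⧸ powSubgroup T N) : ℝ) ≠ 0 := Nat.cast_ne_zero.2 Nat.card_pos.ne'
  rw [energyHess_apply hT ⟨N, hN⟩ hV, mean_eq_cosetMean hT hN hper, cosetMean_eq_sum,
    mul_inv_cancel_left₀ hcard]

theorem norm_sq_eq_dotProduct {R : Finset G} (y : Loc R) :
    ‖y‖ ^ 2 = (fun a : R × (Fin d₁ ⊕ Fin d₂) => y a.1 a.2) ⬝ᵥ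
      fun a : R × (Fin d₁ ⊕ Fin d₂) => y a.1 a.2 := by
  rw [PiLp.norm_sq_eq_of_L2, dotProduct, Fintype.sum_prod_type]
  simp only [EuclideanSpace.real_norm_sq_eq]
  simp only [sq]

omit [(powSubgroup T N).Normal] in
theorem card_mul_sq_rigSeminorm (hT : HasFinitePeriods T)
    (K : Submodule ℝ (Matrix (Fin d₁ ⊕ Fin d₂) (Fin d₁ ⊕ Fin d₂) ℝ)) (R : Finset G)
    [Fintype (G ⧸ powSubgroup T N)] (hN : N ∈ periods T) {u : Uper T}
    (hu : IsPeriodicWith T N (⇑u.1 : G → Eu (Fin d₁ ⊕ Fin d₂))) :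
    Nat.card (G ⧸ powSubgroup T N) * rigSeminorm K T x₀ R ⇑u.1 ^ 2 = ∑ q : G ⧸ powSubgroup T N,
      (fun a : R × (Fin d₁ ⊕ Fin d₂) =>
        isoProj K x₀ R (WithLp.toLp 2 fun h : R => u.1 (q.out * h.1)) a.1 a.2) ⬝ᵥ
      fun a : R × (Fin d₁ ⊕ Fin d₂) =>
        isoProj K x₀ R (WithLp.toLp 2 fun h : R => u.1 (q.out * h.1)) a.1 a.2 := by
  have hcard : (Nat.card (G ⧸ powSubgroup T N) : ℝ) ≠ 0 := Nat.cast_ne_zero.2 Nat.card_pos.ne'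
  rw [sq_rigSeminorm hT ⟨N, hN⟩ K R u hN hu, cosetMean_eq_sum, mul_inv_cancel_left₀ hcard]
  exact Finset.sum_congr rfl fun q _ => norm_sq_eq_dotProduct _

theorem sub_mul_eq_mul_sub {C e r a b : ℝ} (ha : C * e = a) (hb : C * r = b) (c : ℝ) :
    a - c * b = C * (e - c * r) := by
  rw [← ha, ← hb]; ring

theorem stabMatrix_quadratic (hT : HasFinitePeriods T) (hV : IsPotential V)
    (hV0 : HessianIsSum V (refConf G x₀))
    (K : Submodule ℝ (Matrix (Fin d₁ ⊕ Fin d₂) (Fin d₁ ⊕ Fin d₂) ℝ)) (R : Finset G) (c : ℝ)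
    (hN : N ∈ periods T) {u : Uper T}
    (hu : IsPeriodicWith T N (⇑u.1 : G → Eu (Fin d₁ ⊕ Fin d₂))) :
    star (cosetVec (powSubgroup T N) fun g i => u.1 g i) ⬝ᵥ
        (stabMatrix (fV V x₀) (gProj K x₀ R) c (regRep (powSubgroup T N)) *ᵥ
          cosetVec (powSubgroup T N) fun g i => u.1 g i) =
      ((Nat.card (G ⧸ powSubgroup T N) *
        (energyHess T V x₀ u u - c * rigSeminorm K T x₀ R ⇑u.1 ^ 2) : ℝ) : ℂ) := by
  have := Fintype.ofFinite (G ⧸ powSubgroup T N)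
  refine (star_dotProduct_stabMatrix_regRep_mulVec (fourier_fV_quadratic hV hV0 hN hu)
    (fourier_gProj_mulVec_cosetVec K R hN hu)).trans (congrArg _ ?_)
  exact sub_mul_eq_mul_sub (card_mul_energyHess hT hV hN hu)
    (card_mul_sq_rigSeminorm hT K R hN hu) c

/-- A function constant on the cosets of the period subgroup is a periodic displacement, for which
the hypothesis is the required inequality up to the order of the quotient. -/
theorem PosSemidef_stabMatrix_regRep (hT : HasFinitePeriods T) (hV : IsPotential V)
    (hV0 : HessianIsSum V (refConf G x₀))
    (K : Submodule ℝ (Matrix (Fin d₁ ⊕ Fin d₂) (Fin d₁ ⊕ Fin d₂) ℝ)) (R : Finset G) {c : ℝ}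
    (hN : N ∈ periods T)
    (hc : ∀ u : Uper T, c * rigSeminorm K T x₀ R ⇑u.1 ^ 2 ≤ energyHess T V x₀ u u) :
    (stabMatrix (fV V x₀) (gProj K x₀ R) c (regRep (powSubgroup T N))).PosSemidef := by
  refine PosSemidef_stabMatrix_regRep_of_forall (summable_fV hV) (summable_gProj K x₀ R)
    (isHermitian_fourier_fV hV _) fun y hy => ?_
  have hw : IsPeriodicWith T N fun g => (WithLp.toLp 2 (y g) : Eu (Fin d₁ ⊕ Fin d₂)) :=
    fun g t ht => congrArg (WithLp.toLp 2) (hy _ _ (by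
      rw [QuotientGroup.eq]
      simpa using (mem_powSubgroup hN).2 ht))
  have h := stabMatrix_quadratic (u := toUper hT hN _ hw) hT hV hV0 K R c hN hw
  refine le_of_le_of_eq ?_ h.symm
  rw [Complex.zero_le_real]
  exact mul_nonneg (Nat.cast_nonneg _) (sub_nonneg.2 (hc _))

end QuadraticForm

/-! ### The stability criterion and the constants. -/

section Main

variable {d₁ d₂ : ℕ} {G : Subgroup (EucGroup (Fin d₁ ⊕ Fin d₂))} {T : Set G}
  {V : (Punct G → Eu (Fin d₁ ⊕ Fin d₂)) → ℝ} {x₀ : Eu (Fin d₁ ⊕ Fin d₂)}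

theorem stability_iff (hT : HasFinitePeriods T) (hV : IsPotential V)
    (hV0 : HessianIsSum V (refConf G x₀))
    (K : Submodule ℝ (Matrix (Fin d₁ ⊕ Fin d₂) (Fin d₁ ⊕ Fin d₂) ℝ)) (R : Finset G)
    {EE : Set (Σ n : ℕ, UnitaryRep G n)} (hEE : IsPeriodicDualSet T EE) (c : ℝ) :
    (∀ u : Uper T, c * rigSeminorm K T x₀ R ⇑u.1 ^ 2 ≤ energyHess T V x₀ u u) ↔
      ∀ ρ ∈ EE, (stabMatrix (fV V x₀) (gProj K x₀ R) c ρ.2).PosSemidef := by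
  classical
  constructor
  · intro hc ρ hρ
    obtain ⟨N, hN, hper⟩ := (hEE.1 ρ hρ).2
    have := normal_powSubgroup hN
    have := hT.finite N hN
    exact PosSemidef_stabMatrix_of_regRep (summable_fV hV) (summable_gProj K x₀ R)
      (PosSemidef_stabMatrix_regRep hT hV hV0 K R hN hc) ρ.2
      fun g h hgh => hper.eq_of_mk_eq hN hgh
  · intro hc u
    by_cases hne : (periods T).Nonempty
    · obtain ⟨N, hN, hu⟩ := isPeriodic_of_mem_Uper hT hne u
      have := normal_powSubgroup hN
      have := hT.finite N hN
      have hreg : IsPeriodicWith T N (regRep (powSubgroup T N)) := fun g t ht => by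
        have h1 : (t : G ⧸ powSubgroup T N) = 1 :=
          (QuotientGroup.eq_one_iff t).2 ((mem_powSubgroup hN).2 ht)
        apply Subtype.ext
        rw [coe_regRep, coe_regRep, regMatrix_mul]
        refine eq_of_mulVec_eq fun w => ?_
        funext a
        rw [← Matrix.mulVec_mulVec, regMatrix_mulVec, regMatrix_mulVec, regMatrix_mulVec, h1]
        simp
      have h := (PosSemidef_stabMatrix_of_dualSet (summable_fV hV) (summable_gProj K x₀ R) hEE hc
        hN _ _ hreg).dotProduct_mulVec_nonneg (cosetVec (powSubgroup T N) fun g i => u.1 g i)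
      rw [stabMatrix_quadratic hT hV hV0 K R c hN hu, Complex.zero_le_real] at h
      exact sub_nonneg.1 (nonneg_of_mul_nonneg_right h (Nat.cast_pos.2 Nat.card_pos))
    -- Without any period the space of periodic functions is trivial and both sides vanish.
    · have hbot : Uper T = ⊥ := by
        rw [Uper, Submodule.span_eq_bot]
        rintro w ⟨N, hN, -⟩
        exact absurd ⟨N, hN⟩ hne
      have hu : u = 0 := Subtype.ext ((Submodule.mem_bot ℝ).1 (hbot ▸ u.2))
      have hzero : (WithLp.toLp 2 fun _ : R => (0 : Eu (Fin d₁ ⊕ Fin d₂))) = (0 : Loc R) := rfl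
      subst hu
      simp [rigSeminorm, cosetMean, hzero]

/-- A real number strictly below the infimum lies below some element of every `S a`, hence in every
`S a` by downward closure. Empty and unbounded sets are covered by the extended real conventions. -/
theorem sSup_image_coe_forall_mem {α : Type*} (A : Set α) (S : α → Set ℝ)
    (hS : ∀ a ∈ A, ∀ c ∈ S a, ∀ c' ≤ c, c' ∈ S a) :
    sSup ((fun c : ℝ => (c : EReal)) '' {c | ∀ a ∈ A, c ∈ S a}) =
      ⨅ a ∈ A, sSup ((fun c : ℝ => (c : EReal)) '' S a) := by
  apply le_antisymm
  · exact le_iInf₂ fun a ha => sSup_le_sSup (Set.image_mono fun c hc => hc a ha)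
  · refine EReal.ge_of_forall_gt_iff_ge.1 fun z hz => le_sSup ⟨z, fun a ha => ?_, rfl⟩
    obtain ⟨_, ⟨c, hc, rfl⟩, hzc⟩ := lt_sSup_iff.1 (hz.trans_le (iInf₂_le a ha))
    exact hS a ha c hc z (EReal.coe_lt_coe_iff.1 hzc).le

/-- Decreasing `c` adds a nonnegative multiple of `ĝᴴ ĝ`. -/
theorem PosSemidef_stabMatrix_of_le {Γ κ ι : Type} [Group Γ] [Fintype κ] [Fintype ι]
    {f : Γ → Matrix ι ι ℝ} {g : Γ → Matrix κ ι ℝ} {n : ℕ} {ρ : UnitaryRep Γ n} {c c' : ℝ}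
    (h : (stabMatrix f g c ρ).PosSemidef) (hc : c' ≤ c) : (stabMatrix f g c' ρ).PosSemidef := by
  have h1 := h.add ((Matrix.posSemidef_conjTranspose_mul_self (fourier g ρ)).smul
    (a := ((c - c' : ℝ) : ℂ)) (by simpa using hc))
  convert h1 using 1
  rw [stabMatrix, stabMatrix, Complex.ofReal_sub, sub_smul]
  abel

theorem stabConst_eq_iInf (hT : HasFinitePeriods T) (hV : IsPotential V)
    (hV0 : HessianIsSum V (refConf G x₀))
    (K : Submodule ℝ (Matrix (Fin d₁ ⊕ Fin d₂) (Fin d₁ ⊕ Fin d₂) ℝ)) (R : Finset G)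
    {EE : Set (Σ n : ℕ, UnitaryRep G n)} (hEE : IsPeriodicDualSet T EE) :
    stabConst K T V x₀ R =
      ⨅ ρ ∈ EE, lambdaMin (fourier (fV V x₀) ρ.2) (fourier (gProj K x₀ R) ρ.2) := by
  have h := sSup_image_coe_forall_mem EE
    (fun ρ => {c : ℝ | (stabMatrix (fV V x₀) (gProj K x₀ R) c ρ.2).PosSemidef})
    fun ρ _ c hc c' hcc => PosSemidef_stabMatrix_of_le hc hcc
  refine Eq.trans ?_ h
  rw [stabConst]
  simp only [stability_iff hT hV hV0 K R hEE]
  rfl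

end Main

end Objective

end

theorem mainTheorem2 {d₁ d₂ : ℕ}
    (G : Subgroup (Objective.EucGroup (Fin d₁ ⊕ Fin d₂)))
    (hG : Objective.IsStandardDiscrete G) (hG1 : Nontrivial G)
    (T : Set G) (hT : Objective.IsTranslationSection G T)
    (x₀ : Objective.Eu (Fin d₁ ⊕ Fin d₂))
    (hx₀ : Function.Injective fun g : G => g.1 x₀)
    (V : (Objective.Punct G → Objective.Eu (Fin d₁ ⊕ Fin d₂)) → ℝ)
    (hV : Objective.IsPotential V)
    (hV0 : Objective.HessianIsSum V (Objective.refConf G x₀))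
    (R : Finset G) (hR : Objective.Property2 x₀ (R : Set G))
    (EE : Set (Σ n : ℕ, Objective.UnitaryRep G n))
    (hEE : Objective.IsPeriodicDualSet T EE) :
    Objective.lambdaA T V x₀ R =
      (⨅ ρ ∈ EE, Objective.lambdaMin
        (Objective.fourier (Objective.fV V x₀) ρ.2)
        (Objective.fourier (Objective.gR x₀ R) ρ.2)) ∧
    Objective.lambdaA00 T V x₀ R =
      (⨅ ρ ∈ EE, Objective.lambdaMin
        (Objective.fourier (Objective.fV V x₀) ρ.2)
        (Objective.fourier (Objective.gR00 x₀ R) ρ.2)) := by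
  have hFP := hT.hasFinitePeriods hG hx₀
  exact ⟨Objective.stabConst_eq_iInf hFP hV hV0 _ R hEE,
    Objective.stabConst_eq_iInf hFP hV hV0 _ R hEE⟩
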